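/- Let $\mathbb S$ be a connected compact oriented surface with a finite non-empty set of marked points, with at least one marked point on each boundary component; the marked points in the interior are called punctures. Assume that $\mathbb S$ has at least one puncture and is not a once-punctured monogon or a sphere with at most two punctures, and let $k\ge 3$. Let $D_{n,1}$ be the once-punctured $n$-gon (a disk with $n$ marked points on its boundary and one puncture). A triangulation $\Delta$ of $\mathbb S$ by arcs between marked points is *regular* if no arc is a loop enclosing a single puncture (equivalently, each triangle has three distinct sides), and *taut* if moreover each triangle has at most one side which is a boundary interval. Let $Q_k$ be the quiver whose vertices are the triples $(a,b,c)\in\mathbb Z_{\ge 0}^3$ with $a+b+c=k$ other than $(k,0,0),(0,k,0),(0,0,k)$, drawn in a triangle with top corner $(k,0,0)$, bottom right corner $(0,k,0)$ and bottom left corner $(0,0,k)$, with arrows $(a+1,b+1,c)\to(a+1,b,c+1)\to(a,b+1,c+1)\to(a+1,b+1,c)$ for $a+b+c=k-2$. Let $Q_k^1$ be obtained from it by identifying $(a,1,c)$ with $(a,1+c,0)$ whenever $a\ne 0$ and deleting all remaining vertices with $b\ge 2$. * For a regular $\Delta$, the initial quiver $Q_k(\Delta)$ of the cluster algebra $\mathscr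 A(\mathrm{SL}_k,\mathbb S)$ is obtained by placing $Q_k$, preserving orientation, in each triangle, identifying the $k-1$ vertices on the common sides of triangles, and cancelling oriented two-cycles; the vertices on boundary intervals are frozen. * For a taut $\Delta$, the initial quiver $Q'_k(\Delta)$ of $\mathscr A'(\mathrm{SL}_k,\mathbb S)$ is obtained in the same way, except that a triangle with a side on the boundary carries $Q_k^1$, placed with its bottom side on the boundary; the vertex on each boundary interval is frozen. Such a cluster algebra has *finite mutation type* if only finitely many quivers are obtained by mutations from the mutable part of its initial quiver. **Proposition.** For the initial seed given by any regular triangulation $\Delta$ of $\mathbb S$, the cluster algebra $\mathscr A(\mathrm{SL}_k,\mathbb S)$ has finite mutation type if and only if $\mathbb S=D_{2,1}$ is a once-punctured digon and $k=3$. For the initial seed given by any taut triangulation $\Delta$ of $\mathbb S$, the cluster algebra $\mathscr A'(\mathrm{SL}_k,\mathbb S)$ has finite mutation type if and only if either $\mathbb S=D_{2,1}$ and $k\in\{3,4\}$, or $\mathbb S=D_{3,1}$ is a once-punctured triangle and $k=3$. -/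

import Mathlib

/-! ### Exchange matrices and their mutations -/

/-- The exchange matrix of a quiver without loops and oriented two-cycles:
`B i j` is the number of arrows `i → j` minus the number of arrows `j → i`.
Mutation at the vertex `v`: for each path `i → v → j` an arrow `i → j` is added, the arrows at `v`
are reversed, and two-cycles are cancelled. -/
noncomputable def Matrix.quiverMutation {N : Type*} (v : N) (B : Matrix N N ℤ) : Matrix N N ℤ :=
  open Classical in
  Matrix.of fun i j =>
    if i = v ∨ j = v then -B i j
    else B i j + (max (B i v) 0 * max (B v j) 0 - max (-B i v) 0 * max (-B v j) 0)

/-- `B'` is obtained from `B` by a finite sequence of mutations. -/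
def Matrix.MutationEquivalent {N : Type*} (B B' : Matrix N N ℤ) : Prop :=
  Relation.ReflTransGen (fun C C' => ∃ v : N, C' = Matrix.quiverMutation v C) B B'

/-- A skew-symmetric matrix on a set of mutable vertices has finite mutation type if only finitely
many matrices are obtained from it by mutations. As the vertex set is finite, it does not matter
whether the matrices are counted as they are or up to relabelling the vertices. -/
def Matrix.FiniteMutationType {N : Type*} (B : Matrix N N ℤ) : Prop :=
  {B' : Matrix N N ℤ | B.MutationEquivalent B'}.Finite

/-- Given a set `L` of vertices with an arrow relation and a relation `r` along which vertices are
glued, the matrix of the glued quiver: the net number of arrows between two classes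
(so that loops disappear and oriented two-cycles cancel). -/
noncomputable def gluedQuiver {L : Type*} (arrow r : L → L → Prop) :
    Matrix (Quot r) (Quot r) ℤ :=
  Matrix.of fun u v =>
    (Set.ncard {p : L × L | arrow p.1 p.2 ∧ Quot.mk r p.1 = u ∧ Quot.mk r p.2 = v} : ℤ)
      - (Set.ncard {p : L × L | arrow p.1 p.2 ∧ Quot.mk r p.1 = v ∧ Quot.mk r p.2 = u} : ℤ)

/-! ### Marked surfaces and their triangulations -/

/-- A connected compact oriented surface with marked points, up to homeomorphism: its genus, the
number of marked points in the interior (punctures), and for each boundary component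
the (positive) number of marked points on it. -/
@[ext]
structure MarkedSurface where
  genus : ℕ
  punctures : ℕ
  boundary : Multiset ℕ
  boundary_pos : ∀ n ∈ boundary, 0 < n

/-- The `n`-gon with `h` punctures, for `n ≥ 1`. -/
def MarkedSurface.polygon (n h : ℕ) [NeZero n] : MarkedSurface where
  genus := 0
  punctures := h
  boundary := {n}
  boundary_pos := by
    intro m hm
    rw [Multiset.mem_singleton.mp hm]
    exact Nat.pos_of_ne_zero (NeZero.ne n)

/-- An oriented marked surface cut into triangles, up to homeomorphism: `T` is the set of
triangles, the corners of a triangle are numbered `0, 1, 2` counterclockwise, and the side `(t, i)`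
of the triangle `t` runs from the corner `i` to the corner `i + 1`. The side `s` is glued,
reversing its direction, to the side `glue s`, unless `glue s = s`,
in which case `s` is a boundary interval. -/
structure Triangulation (T : Type*) where
  glue : T × Fin 3 → T × Fin 3
  glue_glue : Function.Involutive glue

namespace Triangulation

variable {T : Type*}

/-- The side `s` is a boundary interval of the surface. -/
def IsBoundary (Δ : Triangulation T) (s : T × Fin 3) : Prop := Δ.glue s = s

/-- The next side of the same triangle, in counterclockwise order. -/
def next : Equiv.Perm (T × Fin 3) := Equiv.prodCongr (Equiv.refl T) (Equiv.addRight 1)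

/-- Cross the side `s` (if it is not a boundary interval) and turn to the next side. If `s` is not
a boundary interval, then `s` and `turn s` start at the same marked point and are successive in the
rotation around it. If `s` is a boundary interval, then `turn s` starts at the
end point of `s`, which is the next marked point on the same boundary component. -/
def turn (Δ : Triangulation T) : Equiv.Perm (T × Fin 3) :=
  (Δ.glue_glue.toPerm Δ.glue).trans next

/-- The cycles of `turn`. The sides of a cycle are those which start at a given puncture, or those
which start at the marked points of a given boundary component. So these cycles are in bijection
with the punctures and the boundary components of the surface. -/
abbrev Cycle (Δ : Triangulation T) : Type _ := Quotient (Equiv.Perm.SameCycle.setoid Δ.turn)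

/-- The number of boundary intervals in a cycle: `0` for a puncture, and the number of marked
points (which is the number of boundary intervals) for a boundary component. -/
noncomputable def boundaryLength (Δ : Triangulation T) (c : Δ.Cycle) : ℕ :=
  Set.ncard {s : T × Fin 3 | Δ.IsBoundary s ∧ (Quotient.mk _ s : Δ.Cycle) = c}

/-- The boundary lengths of all cycles. -/
noncomputable def boundaryLengths [Fintype T] (Δ : Triangulation T) : Multiset ℕ :=
  open Classical in
  (Finset.univ : Finset Δ.Cycle).val.map Δ.boundaryLength

/-- The edges of the triangulation (its arcs and the boundary intervals). -/
abbrev Edge (Δ : Triangulation T) : Type _ := Quot fun s s' : T × Fin 3 => Δ.glue s = s'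

/-- The triangles, glued along their sides, form the marked surface `S`. (The type of a connected
compact oriented surface is determined by the boundary and the Euler characteristic
`#vertices - #edges + #triangles = 2 - 2 * genus - #boundary components`.) -/
structure Triangulates [Fintype T] (Δ : Triangulation T) (S : MarkedSurface) : Prop where
  connected : ∀ t t' : T,
    Relation.ReflTransGen (fun a b => ∃ i j, Δ.glue (a, i) = (b, j)) t t'
  punctures : Δ.boundaryLengths.count 0 = S.punctures
  boundary : Δ.boundaryLengths.filter (0 < ·) = S.boundary
  genus : ((S.punctures + S.boundary.sum : ℕ) : ℤ) - (Nat.card Δ.Edge : ℤ) + (Fintype.card T : ℤ)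
    = 2 - 2 * (S.genus : ℤ) - (Multiset.card S.boundary : ℤ)

/-- A triangulation is regular if no two sides of one triangle are glued to each other, i.e. there
is no loop which encloses a single puncture (and the surface is not a once-punctured monogon). -/
def Regular (Δ : Triangulation T) : Prop :=
  ∀ s, ¬ Δ.IsBoundary s → (Δ.glue s).1 ≠ s.1

/-- A regular triangulation is taut if each triangle has at most one side which is a
boundary interval. -/
def Taut (Δ : Triangulation T) : Prop :=
  Δ.Regular ∧ ∀ t i j, Δ.IsBoundary (t, i) → Δ.IsBoundary (t, j) → i = j

end Triangulation

/-! ### The quiver of a triangle -/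

/-- The vertices of the quiver `Q_k`: triples of natural numbers with sum `k`, different from
`(k, 0, 0)`, `(0, k, 0)`, `(0, 0, k)`; that is, all entries are less than `k`. In a triangle, the
coordinate `x i` belongs to the corner `i`, so the side from the corner `i` to the
corner `i + 1` consists of the triples with `x (i + 2) = 0`. -/
abbrev Hive (k : ℕ) : Type :=
  {x : Fin 3 → Fin k // (x 0 : ℕ) + (x 1 : ℕ) + (x 2 : ℕ) = k}

/-- The coordinates of a vertex of `Q_k`. -/
def Hive.coord {k : ℕ} (x : Hive k) (i : Fin 3) : ℕ := (x.1 i : ℕ)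

/-- The arrows of `Q_k`: for each triple `y` with sum `k - 2` there is a small counterclockwise
triangle `y + e 0 + e 2 → y + e 0 + e 1 → y + e 1 + e 2 → y + e 0 + e 2`. In other words, there is
an arrow `x → x'` whenever `x' = x + e (i + 1) - e (i + 2)` and `x i ≥ 1` for some `i`. -/
def Hive.Arrow {k : ℕ} (x x' : Hive k) : Prop :=
  ∃ i : Fin 3, 1 ≤ x.coord i ∧ x'.coord i = x.coord i ∧
    x'.coord (i + 1) = x.coord (i + 1) + 1 ∧ x.coord (i + 2) = x'.coord (i + 2) + 1

namespace Triangulation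

variable {T : Type*}

/-- Arrows in the disjoint union of the quivers `Q_k` of the triangles. -/
def PieceArrow {k : ℕ} (p q : T × Hive k) : Prop := p.1 = q.1 ∧ p.2.Arrow q.2

/-- The vertex `p` lies on the side `i` of its triangle. -/
def OnSide {k : ℕ} (p : T × Hive k) (i : Fin 3) : Prop := p.2.coord (i + 2) = 0

/-- Two vertices which lie on sides glued to each other are identified by the gluing. -/
def Glued (Δ : Triangulation T) {k : ℕ} (p q : T × Hive k) : Prop :=
  ∃ i j : Fin 3, ¬ Δ.IsBoundary (p.1, i) ∧ Δ.glue (p.1, i) = (q.1, j) ∧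
    OnSide p i ∧ OnSide q j ∧
    q.2.coord (j + 1) = p.2.coord i ∧ q.2.coord j = p.2.coord (i + 1)

/-- The vertex `p` lies on a boundary interval. -/
def OnBoundary (Δ : Triangulation T) {k : ℕ} (p : T × Hive k) : Prop :=
  ∃ i, Δ.IsBoundary (p.1, i) ∧ OnSide p i

/-! ### Decorations by affine flags at all marked points -/

/-- The mutable vertices of the quiver `Q_k(Δ)`: all vertices of the glued quiver, except for the
frozen ones on the boundary intervals. -/
abbrev FGMutable (Δ : Triangulation T) (k : ℕ) : Type _ :=
  {v : Quot (Δ.Glued (k := k)) // ∀ p : T × Hive k, Quot.mk _ p = v → ¬ Δ.OnBoundary p}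

/-- The mutable part of the quiver `Q_k(Δ)` of the initial seed of the cluster algebra
`A(SL_k, S)` which is given by a regular triangulation `Δ` of `S`. -/
noncomputable def fgQuiver (Δ : Triangulation T) (k : ℕ) :
    Matrix (Δ.FGMutable k) (Δ.FGMutable k) ℤ :=
  (gluedQuiver PieceArrow (Δ.Glued (k := k))).submatrix Subtype.val Subtype.val

/-! ### Decorations by vectors at the boundary points

In a triangle whose side `j` is a boundary interval, write `(a, b, c)` for the coordinates at the
corners `j + 2`, `j + 1`, `j`. If the triangle is drawn with the side `j` at the bottom, these are
the top, the bottom right and the bottom left corner. Such a triangle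
carries the quiver `Q_k^1`, which is obtained from `Q_k` by identifying `(a, 1, c)` with
`(a, 1 + c, 0)` for `a ≠ 0` and deleting all remaining vertices with `b ≥ 2`. -/

/-- The vertex `p` of `Q_k` is not deleted: if it belongs to a triangle with a boundary side, then
`b ≤ 1`, or it lies on the right side, so that it is identified with a vertex with `b = 1`. -/
def Retained (Δ : Triangulation T) {k : ℕ} (p : T × Hive k) : Prop :=
  ∀ j, Δ.IsBoundary (p.1, j) →
    p.2.coord (j + 1) ≤ 1 ∨ (p.2.coord j = 0 ∧ p.2.coord (j + 2) ≠ 0)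

/-- In a triangle with a boundary side, `(a, 1, c)` is identified with `(a, 1 + c, 0)`
for `a ≠ 0`. -/
def Collapsed (Δ : Triangulation T) {k : ℕ} (p q : T × Hive k) : Prop :=
  p.1 = q.1 ∧ ∃ j, Δ.IsBoundary (p.1, j) ∧ p.2.coord (j + 2) ≠ 0 ∧ p.2.coord (j + 1) = 1 ∧
    q.2.coord (j + 2) = p.2.coord (j + 2) ∧ q.2.coord (j + 1) = 1 + p.2.coord j ∧ q.2.coord j = 0

/-- The vertices of the pieces `Q_k` and `Q_k^1`, before the identifications. -/
abbrev GrPiece (Δ : Triangulation T) (k : ℕ) : Type _ := {p : T × Hive k // Δ.Retained p}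

/-- The identifications within the pieces `Q_k^1` and along the common sides of triangles. -/
def GrGlued (Δ : Triangulation T) {k : ℕ} (p q : Δ.GrPiece k) : Prop :=
  Δ.Glued p.1 q.1 ∨ Δ.Collapsed p.1 q.1

/-- The mutable vertices of the quiver `Q'_k(Δ)`: all vertices of the glued quiver, except for the
frozen ones on the boundary intervals (one on each). -/
abbrev GrMutable (Δ : Triangulation T) (k : ℕ) : Type _ :=
  {v : Quot (Δ.GrGlued (k := k)) // ∀ p : Δ.GrPiece k, Quot.mk _ p = v → ¬ Δ.OnBoundary p.1}

/-- The mutable part of the quiver `Q'_k(Δ)` of the initial seed of the cluster algebra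
`A'(SL_k, S)` which is given by a taut triangulation `Δ` of `S`. -/
noncomputable def grQuiver (Δ : Triangulation T) (k : ℕ) :
    Matrix (Δ.GrMutable k) (Δ.GrMutable k) ℤ :=
  (gluedQuiver (fun p q : Δ.GrPiece k => PieceArrow p.1 q.1)
    (Δ.GrGlued (k := k))).submatrix Subtype.val Subtype.val

end Triangulation

namespace Matrix

section Mutation

variable {N N' : Type*}

theorem quiverMutation_of_eq (B : Matrix N N ℤ) {v i j : N} (h : i = v ∨ j = v) :
    quiverMutation v B i j = -B i j := if_pos h

theorem quiverMutation_of_ne (B : Matrix N N ℤ) {v i j : N} (h : ¬(i = v ∨ j = v)) :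
    quiverMutation v B i j =
      B i j + (max (B i v) 0 * max (B v j) 0 - max (-B i v) 0 * max (-B v j) 0) := if_neg h

theorem quiverMutation_submatrix (B : Matrix N N ℤ) {f : N' → N} (hf : f.Injective) (v : N') :
    (quiverMutation (f v) B).submatrix f f = quiverMutation v (B.submatrix f f) := by
  ext i j
  by_cases h : i = v ∨ j = v
  · rw [quiverMutation_of_eq _ h, submatrix_apply,
      quiverMutation_of_eq _ (h.imp (congrArg f) (congrArg f))]
    rfl
  · rw [quiverMutation_of_ne _ h, submatrix_apply,
      quiverMutation_of_ne _ (by simpa [hf.eq_iff] using h)]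
    rfl

theorem MutationEquivalent.submatrix_lift {B : Matrix N N ℤ} {f : N' → N} (hf : f.Injective)
    {C : Matrix N' N' ℤ} (h : (B.submatrix f f).MutationEquivalent C) :
    ∃ B', B.MutationEquivalent B' ∧ B'.submatrix f f = C := by
  induction h with
  | refl => exact ⟨B, .refl, rfl⟩
  | tail _ hv ih =>
    obtain ⟨B', hB', rfl⟩ := ih
    obtain ⟨v, rfl⟩ := hv
    exact ⟨_, hB'.tail ⟨f v, rfl⟩, quiverMutation_submatrix B' hf v⟩

/-- Full subquivers inherit finite mutation type. -/
theorem FiniteMutationType.submatrix {B : Matrix N N ℤ} (hB : B.FiniteMutationType)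
    {f : N' → N} (hf : f.Injective) : (B.submatrix f f).FiniteMutationType := by
  refine (hB.image fun B' => B'.submatrix f f).subset fun C hC => ?_
  obtain ⟨B', hB', rfl⟩ := MutationEquivalent.submatrix_lift hf hC
  exact ⟨B', hB', rfl⟩

theorem FiniteMutationType.of_mutationEquivalent {B B' : Matrix N N ℤ}
    (hB : B.FiniteMutationType) (h : B.MutationEquivalent B') : B'.FiniteMutationType :=
  hB.subset fun _ hC => h.trans hC

theorem quiverMutation_skew {B : Matrix N N ℤ} (hB : ∀ i j, B i j = -B j i) (v i j : N) :
    quiverMutation v B i j = -quiverMutation v B j i := by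
  by_cases h : i = v ∨ j = v
  · rw [quiverMutation_of_eq _ h, quiverMutation_of_eq _ h.symm, hB i j]
  · rw [quiverMutation_of_ne _ h, quiverMutation_of_ne _ (mt Or.symm h), hB i j, hB i v, hB v j]
    simp only [neg_neg]
    ring

theorem MutationEquivalent.skew {B B' : Matrix N N ℤ} (hB : ∀ i j, B i j = -B j i)
    (h : B.MutationEquivalent B') : ∀ i j, B' i j = -B' j i := by
  induction h with
  | refl => exact hB
  | tail _ hv ih =>
    obtain ⟨v, rfl⟩ := hv
    exact quiverMutation_skew ih v

/-- The vertices `i → j → l → i` form an oriented triangle with at least three arrows `i → j`, and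
at least as many arrows `l → i` as `j → l`. -/
def HeavyTriangle (B : Matrix N N ℤ) (i j l : N) : Prop :=
  3 ≤ B i j ∧ 0 < B j l ∧ B j l ≤ B l i

theorem HeavyTriangle.mutate {B : Matrix N N ℤ} (hB : ∀ i j, B i j = -B j i) {i j l : N}
    (h : B.HeavyTriangle i j l) :
    (quiverMutation i B).HeavyTriangle j i l ∧ B l i < quiverMutation i B l j := by
  obtain ⟨h1, h2, h3⟩ := h
  have hii : ∀ a, B a a = 0 := fun a => by have := hB a a; omega
  have hij : j ≠ i := by rintro rfl; rw [hii] at h1; omega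
  have hil : l ≠ i := by rintro rfl; rw [hii] at h3; omega
  have e1 : quiverMutation i B j i = B i j := by
    simp [quiverMutation, hB j i]
  have e2 : quiverMutation i B i l = B l i := by
    simp [quiverMutation, hB i l]
  have e3 : quiverMutation i B l j = B l i * B i j - B j l := by
    simp only [quiverMutation, of_apply, hij, hil, or_self, if_false]
    rw [max_eq_left (by omega : (0 : ℤ) ≤ B l i), max_eq_left (by omega : (0 : ℤ) ≤ B i j),
      max_eq_right (by omega : -B l i ≤ (0 : ℤ)), hB l j]
    ring
  have e4 : B l i * 3 ≤ B l i * B i j := by gcongr; omega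
  refine ⟨⟨?_, ?_, ?_⟩, ?_⟩
  · rw [e1]; exact h1
  · rw [e2]; omega
  · rw [e2, e3]; omega
  · rw [e3]; omega

theorem HeavyTriangle.exists_large {B : Matrix N N ℤ} (hB : ∀ i j, B i j = -B j i) {i j l : N}
    (h : B.HeavyTriangle i j l) (n : ℕ) :
    ∃ B', B.MutationEquivalent B' ∧
      ((B'.HeavyTriangle i j l ∧ (n : ℤ) ≤ B' l i) ∨
        (B'.HeavyTriangle j i l ∧ (n : ℤ) ≤ B' l j)) := by
  induction n with
  | zero => exact ⟨B, .refl, .inl ⟨h, by have := h.2.1; have := h.2.2; push_cast; omega⟩⟩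
  | succ n ih =>
    obtain ⟨B', hB', ⟨ht, hn⟩ | ⟨ht, hn⟩⟩ := ih
    · obtain ⟨ht', hn'⟩ := ht.mutate (hB'.skew hB)
      exact ⟨_, hB'.tail ⟨i, rfl⟩, .inr ⟨ht', by push_cast; omega⟩⟩
    · obtain ⟨ht', hn'⟩ := ht.mutate (hB'.skew hB)
      exact ⟨_, hB'.tail ⟨j, rfl⟩, .inl ⟨ht', by push_cast; omega⟩⟩

theorem HeavyTriangle.not_finiteMutationType {B : Matrix N N ℤ} (hB : ∀ i j, B i j = -B j i)
    {i j l : N} (h : B.HeavyTriangle i j l) : ¬ B.FiniteMutationType := by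
  intro hfin
  obtain ⟨b, hb⟩ := (hfin.image fun C => max (C l i) (C l j)).bddAbove
  obtain ⟨B', hB', hn⟩ := h.exists_large hB (b.toNat + 1)
  have hle := hb ⟨B', hB', rfl⟩
  simp only [max_le_iff] at hle
  rcases hn with ⟨-, hn⟩ | ⟨-, hn⟩ <;> push_cast at hn <;> omega

/-- If mutations of each matrix of a finite family are relabelled members of the family, then the
members have finite mutation type. -/
theorem finiteMutationType_of_closed [Finite N] {ι : Type*} [Finite ι] (R : ι → Matrix N N ℤ)
    (h : ∀ a v, ∃ b, ∃ σ : Equiv.Perm N, quiverMutation v (R a) = (R b).submatrix σ σ) (a : ι) :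
    (R a).FiniteMutationType := by
  refine (Set.finite_range fun p : ι × Equiv.Perm N => (R p.1).submatrix p.2 p.2).subset
    fun C hC => ?_
  induction hC with
  | refl => exact ⟨(a, 1), by ext; simp⟩
  | tail _ hv ih =>
    obtain ⟨v, rfl⟩ := hv
    obtain ⟨⟨b, σ⟩, rfl⟩ := ih
    obtain ⟨b', τ, hτ⟩ := h b (σ v)
    refine ⟨(b', σ.trans τ), ?_⟩
    change _ = quiverMutation v ((R b).submatrix σ σ)
    rw [← quiverMutation_submatrix (R b) σ.injective, hτ]
    rfl

end Mutation

/-- Mutation of a matrix which is given by the list of its rows. -/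
def mutateRows (v : ℕ) (L : List (List ℤ)) : List (List ℤ) :=
  (L.zipIdx).map fun r => (r.1.zip (L.getD v [])).zipIdx.map fun b =>
    if r.2 = v ∨ b.2 = v then -b.1.1
    else b.1.1 + (max (r.1.getD v 0) 0 * max b.1.2 0 - max (-r.1.getD v 0) 0 * max (-b.1.2) 0)

/-- `L` is the list of the rows of `B`. -/
def HasRows {n : ℕ} (B : Matrix (Fin n) (Fin n) ℤ) (L : List (List ℤ)) : Prop :=
  L = List.ofFn fun i => List.ofFn (B i)

theorem HasRows.getD {n : ℕ} {B : Matrix (Fin n) (Fin n) ℤ} {L : List (List ℤ)}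
    (h : B.HasRows L) (i j : Fin n) : (L.getD i []).getD j 0 = B i j := by
  subst h
  simp [List.getD]

theorem HasRows.mutate {n : ℕ} {B : Matrix (Fin n) (Fin n) ℤ} {L : List (List ℤ)}
    (h : B.HasRows L) (v : Fin n) : (quiverMutation v B).HasRows (mutateRows v L) := by
  subst h
  apply List.ext_getElem
  · simp [mutateRows]
  · intro i h1 h2
    have hi : i < n := by simpa using h2
    apply List.ext_getElem
    · simp [mutateRows, List.getD]
    · intro j h3 h4
      have hj : j < n := by simpa using h4
      simp [mutateRows, quiverMutation, List.getD, Fin.ext_iff]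

/-- The mutation sequence `vs` turns the matrix with the rows `L` into one with a heavy
triangle `i j l`. -/
def heavyAfter (n : ℕ) (L : List (List ℤ)) (vs : List ℕ) (i j l : ℕ) : Bool :=
  let R := vs.foldl (fun R v => mutateRows v R) L
  let e (a b : ℕ) : ℤ := (R.getD a []).getD b 0
  vs.all (· < n) && i < n && j < n && l < n && 3 ≤ e i j && 0 < e j l && e j l ≤ e l i

theorem HasRows.mutate_foldl {n : ℕ} {B : Matrix (Fin n) (Fin n) ℤ} {L : List (List ℤ)}
    (h : B.HasRows L) {vs : List ℕ} (hvs : ∀ v ∈ vs, v < n) :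
    ∃ B', B.MutationEquivalent B' ∧ B'.HasRows (vs.foldl (fun R v => mutateRows v R) L) := by
  induction vs generalizing B L with
  | nil => exact ⟨B, .refl, h⟩
  | cons v vs ih =>
    obtain ⟨B', hB', h'⟩ := ih (h.mutate ⟨v, hvs v (by simp)⟩) fun w hw => hvs w (by simp [hw])
    exact ⟨B', .head ⟨_, rfl⟩ hB', h'⟩

theorem HasRows.not_finiteMutationType {n : ℕ} {B : Matrix (Fin n) (Fin n) ℤ}
    {L : List (List ℤ)} (h : B.HasRows L) (hB : ∀ i j, B i j = -B j i) {vs : List ℕ} {i j l : ℕ}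
    (hvs : heavyAfter n L vs i j l = true) : ¬ B.FiniteMutationType := by
  simp only [heavyAfter, Bool.and_eq_true, List.all_eq_true, decide_eq_true_eq] at hvs
  obtain ⟨⟨⟨⟨⟨⟨hv, hi⟩, hj⟩, hl⟩, h1⟩, h2⟩, h3⟩ := hvs
  obtain ⟨B', hB', h'⟩ := h.mutate_foldl hv
  have e (a b : ℕ) (ha : a < n) (hb : b < n) := h'.getD ⟨a, ha⟩ ⟨b, hb⟩
  intro hfin
  refine HeavyTriangle.not_finiteMutationType (hB'.skew hB) (i := ⟨i, hi⟩) (j := ⟨j, hj⟩)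
    (l := ⟨l, hl⟩) ⟨?_, ?_, ?_⟩ (hfin.of_mutationEquivalent hB')
  · rw [← e i j hi hj]; exact h1
  · rw [← e j l hj hl]; exact h2
  · rw [← e j l hj hl, ← e l i hl hi]; exact h3

end Matrix

/-! ### Finite models of parts of a triangulation -/

/-- A vertex of the quiver of a triangle of a finite model: the number of the triangle and the
coordinates of the vertex at the corners `0`, `1`, `2`. -/
abbrev ModelPoint : Type := ℕ × ℕ × ℕ × ℕ

/-- Pairs of glued sides of the triangles of a finite model. -/
abbrev Links : Type := List ((ℕ × Fin 3) × (ℕ × Fin 3))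

namespace ModelPoint

/-- The coordinates of a vertex. -/
def cd (P : ModelPoint) : Fin 3 → ℕ
  | 0 => P.2.1
  | 1 => P.2.2.1
  | 2 => P.2.2.2

/-- The vertex of the triangle `i` with the coordinates `a`, `b`, `c` at the corners
`j`, `j + 1`, `j + 2`. -/
def rotated (i : ℕ) : Fin 3 → ℕ → ℕ → ℕ → ModelPoint
  | 0, a, b, c => (i, a, b, c)
  | 1, a, b, c => (i, c, a, b)
  | 2, a, b, c => (i, b, c, a)

/-- There is an arrow from `P` to `Q` in one of the triangles. -/
def arrow (P Q : ModelPoint) : Bool :=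
  P.1 == Q.1 &&
    ((1 ≤ P.2.1 && Q.2.1 == P.2.1 && Q.2.2.1 == P.2.2.1 + 1 && P.2.2.2 == Q.2.2.2 + 1) ||
     (1 ≤ P.2.2.1 && Q.2.2.1 == P.2.2.1 && Q.2.2.2 == P.2.2.2 + 1 && P.2.1 == Q.2.1 + 1) ||
     (1 ≤ P.2.2.2 && Q.2.2.2 == P.2.2.2 && Q.2.1 == P.2.1 + 1 && P.2.2.1 == Q.2.2.1 + 1))

/-- The vertex `P` is not deleted. Here and below, the entry `i` of `w` tells whether the triangle
`i` carries the quiver `Q_k^1`, with the side `1` at the bottom. -/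
def retained (w : List Bool) (P : ModelPoint) : Bool :=
  !w.getD P.1 false || P.2.2.2 ≤ 1 || (P.2.2.1 == 0 && P.2.1 != 0)

end ModelPoint

namespace Links

open ModelPoint

/-- The side which is glued to the side `s`. -/
def partner (K : Links) (s : ℕ × Fin 3) : Option (ℕ × Fin 3) :=
  K.findSome? fun l => if l.1 = s then some l.2 else if l.2 = s then some l.1 else none

/-- The vertices which are identified with `P` by the gluing. -/
def mirror (K : Links) (P : ModelPoint) : List ModelPoint :=
  ([0, 1, 2] : List (Fin 3)).flatMap fun j =>
    if P.cd (j + 2) = 0 then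
      match K.partner (P.1, j) with
      | none => []
      | some s => [rotated s.1 s.2 (P.cd (j + 1)) (P.cd j) 0]
    else []

/-- The vertices which are identified with `P` inside of its triangle. -/
def collapse (w : List Bool) (P : ModelPoint) : List ModelPoint :=
  if w.getD P.1 false ∧ P.2.1 ≠ 0 then
    (if P.2.2.2 = 1 then [(P.1, P.2.1, 0, 1 + P.2.2.1)] else []) ++
      (if P.2.2.1 = 0 ∧ 1 ≤ P.2.2.2 then [(P.1, P.2.1, P.2.2.2 - 1, 1)] else [])
  else []

/-- The vertices which are identified with `P`. -/
def moves (K : Links) (w : List Bool) (P : ModelPoint) : List ModelPoint :=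
  (K.mirror P ++ collapse w P).filter (retained w)

/-- The vertices which are reached from those in `C` by at most `n` identifications. -/
def saturate (K : Links) (w : List Bool) : ℕ → List ModelPoint → List ModelPoint
  | 0, C => C
  | n + 1, C => saturate K w n ((C.flatMap (K.moves w)).foldl (fun C Q => C.insert Q) C)

/-- `C` is a class of identified mutable vertices. If `apex` is true,
then the coordinates at the corner `0` are positive. -/
def closedClass (K : Links) (w : List Bool) (k : ℕ) (apex : Bool) (C : List ModelPoint) : Bool :=
  C.all fun P => P.1 < w.length && P.2.1 + P.2.2.1 + P.2.2.2 == k && P.2.1 < k && P.2.2.1 < k &&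
    P.2.2.2 < k && (!apex || 1 ≤ P.2.1) && retained w P &&
    (([0, 1, 2] : List (Fin 3)).all fun j => P.cd (j + 2) != 0 || (K.partner (P.1, j)).isSome) &&
    (K.moves w P).all fun Q => C.contains Q

/-- The classes of the vertices in the list. -/
def classes (K : Links) (w : List Bool) (V : List ModelPoint) : List (List ModelPoint) :=
  V.map fun P => K.saturate w 2 [P]

/-- The vertices in the list `V` represent different mutable vertices of the glued quiver. -/
def independent (K : Links) (w : List Bool) (k : ℕ) (apex : Bool) (V : List ModelPoint) : Bool :=
  ((K.classes w V).all fun C => K.closedClass w k apex C && decide C.Nodup) &&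
    decide ((K.classes w V).Pairwise fun C C' => ∀ P ∈ C, P ∉ C')

/-- The net number of arrows between two classes of vertices. -/
def arrows (C C' : List ModelPoint) : ℤ :=
  ((C.product C').filter fun q => arrow q.1 q.2).length -
    ((C'.product C).filter fun q => arrow q.1 q.2).length

/-- The rows of the matrix of the full subquiver on the given vertices. -/
def rows (K : Links) (w : List Bool) (V : List ModelPoint) : List (List ℤ) :=
  let Cs := K.classes w V
  Cs.map fun C => Cs.map fun C' => arrows C C'

end Links

/-- The ways in which a row of triangles around a puncture can be closed up. -/
inductive FanKind
  | path | fan | twist | ear (j : Fin 3) | sphere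
  deriving DecidableEq

namespace FanKind

/-- The gluing of the sides of a row of `N` triangles which have the corner `0` in common. -/
def row (N : ℕ) : Links := (List.range (N - 1)).map fun i => ((i, 0), (i + 1, 2))

/-- The gluing of the sides for each kind of a row of `N` triangles. -/
def links : FanKind → ℕ → Links
  | path, N => row N
  | fan, N => ((N - 1, 0), (0, 2)) :: row N
  | twist, N => ((N - 1, 0), (0, 1)) :: row N
  | ear j, _ => [((0, 0), (1, 2)), ((1, 0), (0, 2)), ((0, 1), (2, j))]
  | sphere, _ => [((0, 0), (1, 2)), ((1, 0), (0, 2)), ((0, 1), (1, 1))]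

/-- In these cases all gluings preserve the coordinates at the corner `0`. -/
def central : FanKind → Bool
  | path => true
  | fan => true
  | _ => false

end FanKind

/-- A sequence of mutations at some of the vertices of the quiver of a row of triangles which leads
to a heavy triangle. -/
structure HeavyCertificate where
  kind : FanKind
  word : List Bool
  level : ℕ
  vertices : List ModelPoint
  mutations : List ℕ
  i : ℕ
  j : ℕ
  l : ℕ

namespace HeavyCertificate

/-- The gluing of the sides. -/
def links (c : HeavyCertificate) : Links := c.kind.links c.word.length

/-- The certificate is correct. -/
def check (c : HeavyCertificate) : Bool :=
  c.links.independent c.word c.level c.kind.central c.vertices &&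
    Matrix.heavyAfter c.vertices.length (c.links.rows c.word c.vertices) c.mutations c.i c.j c.l

/-- Certificates for all rows of triangles which are needed. -/
def table : List HeavyCertificate := [
  ⟨.path, [false, false], 5, [(0, 1, 3, 1), (0, 2, 1, 2), (0, 2, 2, 1), (0, 1, 4, 0),
    (1, 1, 1, 3), (1, 2, 1, 2), (0, 3, 2, 0)], [6, 3, 5, 2, 4, 1, 5, 0], 5, 1, 0⟩,
  ⟨.path, [false, true, false], 5, [(0, 1, 4, 0), (0, 2, 3, 0), (1, 1, 4, 0), (2, 1, 1, 3),
    (2, 2, 1, 2), (2, 2, 2, 1), (1, 3, 2, 0)], [6, 1, 2, 4, 0, 5, 3, 1], 3, 4, 1⟩,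
  ⟨.path, [false, true, true], 5, [(0, 2, 2, 1), (0, 3, 1, 1), (0, 1, 4, 0), (0, 2, 3, 0),
    (0, 4, 1, 0), (1, 3, 2, 0), (1, 4, 1, 0)], [6, 4, 5, 1, 0, 6, 1, 3, 1], 2, 3, 1⟩,
  ⟨.path, [true, true, true, true], 5, [(0, 3, 2, 0), (0, 4, 1, 0), (1, 2, 3, 0), (1, 3, 2, 0),
    (1, 4, 1, 0), (2, 1, 4, 0), (2, 2, 3, 0), (2, 3, 2, 0)], [1, 3, 0, 6, 7, 5, 4, 0, 2], 0, 5, 2⟩,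
  ⟨.fan, [false, true], 5, [(0, 2, 2, 1), (0, 3, 1, 1), (0, 4, 0, 1), (0, 2, 3, 0), (0, 3, 2, 0)],
    [3, 2, 1, 4], 0, 1, 4⟩,
  ⟨.fan, [true, true], 5, [(0, 1, 0, 4), (0, 3, 0, 2), (0, 4, 0, 1), (0, 1, 4, 0), (0, 2, 3, 0),
    (0, 3, 2, 0)], [2, 4, 0, 3, 1], 0, 5, 4⟩,
  ⟨.fan, [true, true, true], 5, [(0, 2, 0, 3), (0, 4, 0, 1), (0, 1, 4, 0), (0, 2, 3, 0),
    (0, 3, 2, 0), (1, 2, 3, 0), (1, 3, 2, 0)], [6, 4, 1, 2, 0, 5], 6, 3, 1⟩,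
  ⟨.twist, [false, true], 5, [(0, 0, 3, 2), (0, 0, 4, 1), (0, 1, 4, 0)], [2, 1], 0, 2, 1⟩,
  ⟨.path, [false, true], 6, [(0, 1, 3, 2), (0, 2, 2, 2), (0, 2, 3, 1), (0, 3, 2, 1), (0, 4, 1, 1),
    (0, 1, 5, 0), (0, 2, 4, 0), (0, 3, 3, 0)], [3, 6, 4, 0, 7, 5, 1, 3, 2], 3, 5, 2⟩,
  ⟨.path, [false, false, false], 4, [(1, 1, 2, 1), (0, 2, 2, 0), (1, 2, 1, 1), (1, 1, 3, 0),
    (2, 1, 1, 2), (2, 2, 1, 1), (1, 3, 1, 0)], [1, 3, 4, 5, 6, 0, 2, 4], 2, 1, 4⟩,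
  ⟨.path, [false, true, false], 4, [(0, 2, 1, 1), (0, 1, 3, 0), (0, 2, 2, 0), (1, 1, 3, 0),
    (2, 1, 1, 2), (2, 2, 1, 1), (1, 3, 1, 0)], [6, 2, 0, 1, 5, 3, 2, 4], 0, 2, 4⟩,
  ⟨.path, [false, true, true, false], 4, [(0, 1, 2, 1), (0, 1, 3, 0), (0, 2, 2, 0), (1, 2, 2, 0),
    (3, 1, 1, 2), (2, 2, 2, 0), (2, 3, 1, 0)], [3, 0, 5, 2, 6, 1, 5, 4], 1, 3, 4⟩,
  ⟨.path, [false, true, true, true], 4, [(0, 2, 1, 1), (0, 1, 3, 0), (0, 2, 2, 0), (1, 1, 3, 0),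
    (1, 2, 2, 0), (1, 3, 1, 0), (2, 2, 2, 0), (2, 3, 1, 0)], [6, 2, 7, 5, 0, 1, 3, 6, 2], 6, 4, 2⟩,
  ⟨.path, [true, true, true, true, true], 4, [(0, 1, 3, 0), (0, 2, 2, 0), (1, 1, 3, 0),
    (1, 3, 1, 0), (2, 2, 2, 0), (2, 3, 1, 0), (3, 2, 2, 0)], [5, 4, 3, 0, 2, 1, 6, 5, 0], 6, 5, 0⟩,
  ⟨.fan, [false, false], 4, [(0, 1, 2, 1), (0, 2, 0, 2), (0, 2, 1, 1), (0, 2, 2, 0), (1, 2, 1, 1),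
    (0, 3, 1, 0)], [5, 0, 1, 4, 2], 3, 4, 2⟩,
  ⟨.fan, [false, true], 4, [(0, 1, 1, 2), (0, 1, 2, 1), (0, 2, 1, 1), (0, 3, 0, 1), (0, 2, 2, 0)],
    [3, 4, 2, 0], 4, 1, 0⟩,
  ⟨.fan, [false, true, true], 4, [(0, 2, 1, 1), (0, 3, 0, 1), (0, 2, 2, 0), (0, 3, 1, 0),
    (1, 2, 2, 0)], [1, 3, 2, 4, 1], 0, 2, 1⟩,
  ⟨.fan, [true, true, true], 4, [(0, 1, 0, 3), (0, 2, 0, 2), (0, 2, 2, 0), (0, 3, 1, 0),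
    (1, 1, 3, 0), (1, 2, 2, 0)], [5, 3, 2, 4, 1, 0], 5, 2, 0⟩,
  ⟨.fan, [true, true, true, true], 4, [(0, 2, 0, 2), (0, 3, 1, 0), (1, 2, 2, 0), (1, 3, 1, 0),
    (2, 2, 2, 0), (2, 3, 1, 0)], [4, 0, 1, 2, 3, 0], 3, 5, 0⟩,
  ⟨.twist, [false, false], 4, [(0, 0, 1, 3), (0, 0, 2, 2), (0, 1, 1, 2), (0, 2, 1, 1),
    (1, 2, 1, 1), (0, 3, 1, 0)], [3, 5, 1, 2, 4], 2, 0, 4⟩,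
  ⟨.twist, [false, true], 4, [(0, 0, 2, 2), (0, 0, 3, 1), (0, 1, 3, 0)], [2, 1], 0, 2, 1⟩,
  ⟨.twist, [false, true, true], 4, [(0, 0, 3, 1), (0, 1, 3, 0), (0, 2, 2, 0), (1, 1, 3, 0)], [3,
    0, 1, 0], 1, 2, 0⟩,
  ⟨.path, [false, false, false, false, false], 3, [(0, 1, 1, 1), (0, 2, 1, 0), (1, 1, 2, 0),
    (2, 1, 1, 1), (1, 2, 1, 0), (2, 1, 2, 0), (3, 1, 1, 1), (2, 2, 1, 0), (3, 1, 2, 0)], [5, 4, 1,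
    3, 6, 4, 8, 7, 2, 0, 6, 4], 3, 6, 4⟩,
  ⟨.path, [false, true, false, false, false], 3, [(0, 1, 1, 1), (0, 1, 2, 0), (0, 2, 1, 0),
    (2, 1, 1, 1), (1, 2, 1, 0), (2, 1, 2, 0), (3, 1, 1, 1), (2, 2, 1, 0), (3, 1, 2, 0)], [0, 5, 4,
    2, 1, 7, 6, 2, 3, 6, 8], 2, 3, 8⟩,
  ⟨.path, [false, true, false, false, true], 3, [(0, 1, 1, 1), (0, 1, 2, 0), (0, 2, 1, 0),
    (2, 1, 1, 1), (1, 2, 1, 0), (2, 1, 2, 0), (3, 1, 1, 1), (2, 2, 1, 0), (3, 1, 2, 0)], [4, 0, 5,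
    6, 2, 7, 1, 2, 3, 2], 3, 8, 2⟩,
  ⟨.path, [false, true, false, true, false], 3, [(0, 1, 1, 1), (0, 1, 2, 0), (0, 2, 1, 0),
    (2, 1, 1, 1), (1, 2, 1, 0), (2, 1, 2, 0), (2, 2, 1, 0), (3, 1, 2, 0)], [4, 6, 2, 0, 1, 3, 6,
    5, 1], 5, 7, 1⟩,
  ⟨.path, [false, true, false, true, true], 3, [(0, 1, 1, 1), (0, 1, 2, 0), (0, 2, 1, 0),
    (2, 1, 1, 1), (1, 2, 1, 0), (2, 1, 2, 0), (2, 2, 1, 0), (3, 1, 2, 0)], [0, 5, 4, 6, 3, 7, 2,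
    1, 6], 1, 3, 6⟩,
  ⟨.path, [false, true, true, false, false], 3, [(0, 1, 1, 1), (0, 1, 2, 0), (1, 1, 2, 0),
    (1, 2, 1, 0), (2, 1, 2, 0), (2, 2, 1, 0), (4, 1, 1, 1), (3, 2, 1, 0)], [5, 7, 2, 1, 0, 4, 5,
    3, 6, 0], 5, 3, 0⟩,
  ⟨.path, [false, true, true, false, true], 3, [(0, 1, 1, 1), (0, 1, 2, 0), (1, 1, 2, 0),
    (1, 2, 1, 0), (3, 1, 1, 1), (2, 2, 1, 0), (3, 1, 2, 0), (3, 2, 1, 0)], [6, 5, 7, 4, 1, 3, 7,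
    2, 7], 0, 2, 7⟩,
  ⟨.path, [false, true, true, true, false, false], 3, [(0, 1, 2, 0), (1, 1, 2, 0), (2, 1, 2, 0),
    (2, 2, 1, 0), (4, 1, 1, 1), (3, 2, 1, 0), (4, 1, 2, 0), (5, 1, 1, 1), (4, 2, 1, 0)], [7, 1, 6,
    5, 3, 8, 2, 4, 0, 3], 2, 4, 3⟩,
  ⟨.path, [false, true, true, true, false, true], 3, [(0, 1, 2, 0), (1, 1, 2, 0), (1, 2, 1, 0),
    (2, 1, 2, 0), (2, 2, 1, 0), (4, 1, 1, 1), (3, 2, 1, 0), (4, 1, 2, 0), (4, 2, 1, 0)], [7, 6, 8,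
    1, 0, 5, 2, 4, 3, 8], 3, 0, 8⟩,
  ⟨.path, [false, true, true, true, true, false], 3, [(0, 2, 1, 0), (1, 1, 2, 0), (1, 2, 1, 0),
    (2, 1, 2, 0), (2, 2, 1, 0), (3, 1, 2, 0), (4, 1, 2, 0), (4, 2, 1, 0)], [5, 2, 3, 7, 5, 6, 1,
    5, 4, 1], 0, 4, 1⟩,
  ⟨.path, [false, true, true, true, true, true], 3, [(0, 1, 1, 1), (0, 1, 2, 0), (1, 1, 2, 0),
    (1, 2, 1, 0), (2, 1, 2, 0), (2, 2, 1, 0), (3, 2, 1, 0), (4, 1, 2, 0), (4, 2, 1, 0)], [1, 7, 2,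
    6, 5, 0, 4, 2, 3, 8, 4], 8, 7, 4⟩,
  ⟨.path, [true, true, true, true, true, true, true], 3, [(0, 2, 1, 0), (1, 1, 2, 0),
    (1, 2, 1, 0), (2, 1, 2, 0), (2, 2, 1, 0), (3, 1, 2, 0), (4, 1, 2, 0), (4, 2, 1, 0),
    (5, 2, 1, 0)], [3, 2, 4, 5, 1, 3, 6, 8, 0, 1, 7], 1, 0, 7⟩,
  ⟨.fan, [false, false, false], 3, [(0, 1, 0, 2), (0, 2, 0, 1), (1, 1, 1, 1), (0, 2, 1, 0),
    (1, 1, 2, 0), (2, 1, 1, 1)], [4, 3, 1, 2, 5, 3], 5, 0, 3⟩,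
  ⟨.fan, [false, false, false, false], 3, [(0, 1, 1, 1), (0, 2, 0, 1), (0, 1, 2, 0), (1, 1, 1, 1),
    (1, 1, 2, 0), (1, 2, 1, 0), (2, 2, 1, 0)], [6, 1, 0, 2, 5, 3, 1], 3, 4, 1⟩,
  ⟨.fan, [true, true, true, true], 3, [(0, 1, 0, 2), (0, 2, 1, 0), (1, 1, 2, 0), (1, 2, 1, 0),
    (2, 1, 2, 0), (2, 2, 1, 0)], [3, 1, 0, 5, 4, 1], 2, 4, 1⟩,
  ⟨.fan, [true, true, true, true, true], 3, [(0, 1, 0, 2), (0, 1, 2, 0), (0, 2, 1, 0),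
    (1, 2, 1, 0), (2, 1, 2, 0), (2, 2, 1, 0), (3, 1, 2, 0)], [3, 5, 4, 6, 2, 0, 5], 0, 1, 5⟩,
  ⟨.fan, [true, true, true, true, true, true], 3, [(0, 1, 0, 2), (0, 2, 0, 1), (0, 1, 2, 0),
    (1, 1, 2, 0), (2, 1, 2, 0), (3, 2, 1, 0), (4, 1, 2, 0), (4, 2, 1, 0)], [7, 3, 2, 5, 4, 1, 0,
    5], 6, 0, 5⟩,
  ⟨.fan, [false, true, false], 3, [(0, 1, 0, 2), (0, 1, 1, 1), (0, 2, 0, 1), (0, 1, 2, 0),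
    (1, 2, 1, 0)], [4, 2, 3, 1, 4], 0, 1, 4⟩,
  ⟨.fan, [false, true, true], 3, [(0, 1, 1, 1), (0, 2, 0, 1), (0, 1, 2, 0), (1, 1, 2, 0),
    (1, 2, 1, 0)], [2, 1, 4, 3, 0], 3, 4, 0⟩,
  ⟨.fan, [false, true, false, false], 3, [(0, 1, 1, 1), (0, 2, 0, 1), (0, 1, 2, 0), (1, 1, 2, 0),
    (1, 2, 1, 0), (2, 2, 1, 0)], [5, 1, 4, 0, 2, 1], 2, 3, 1⟩,
  ⟨.fan, [false, true, false, true], 3, [(0, 1, 1, 1), (0, 2, 0, 1), (0, 1, 2, 0), (1, 1, 2, 0),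
    (1, 2, 1, 0), (2, 2, 1, 0)], [5, 1, 4, 0, 2, 1], 2, 3, 1⟩,
  ⟨.fan, [false, true, true, false], 3, [(0, 1, 0, 2), (0, 1, 1, 1), (0, 2, 0, 1), (0, 1, 2, 0),
    (1, 1, 2, 0), (2, 2, 1, 0)], [5, 3, 4, 2, 1, 5], 0, 1, 5⟩,
  ⟨.fan, [false, true, true, true], 3, [(0, 1, 1, 1), (0, 2, 0, 1), (0, 1, 2, 0), (1, 1, 2, 0),
    (2, 1, 2, 0), (2, 2, 1, 0)], [1, 2, 0, 5, 4, 3], 1, 0, 3⟩,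
  ⟨.fan, [false, true, true, true, false], 3, [(0, 1, 0, 2), (0, 1, 1, 1), (0, 2, 0, 1),
    (0, 1, 2, 0), (1, 2, 1, 0), (2, 2, 1, 0), (3, 2, 1, 0)], [6, 5, 4, 2, 3, 1, 4], 0, 1, 4⟩,
  ⟨.fan, [false, true, true, true, true], 3, [(0, 1, 1, 1), (0, 2, 0, 1), (0, 1, 2, 0),
    (1, 1, 2, 0), (2, 1, 2, 0), (3, 1, 2, 0), (3, 2, 1, 0)], [1, 4, 2, 3, 0, 5, 0], 6, 5, 0⟩,
  ⟨.twist, [false, false], 3, [(0, 0, 1, 2), (0, 0, 2, 1), (0, 1, 2, 0), (1, 1, 1, 1)], [3, 2, 0,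
    1], 3, 2, 1⟩,
  ⟨.twist, [false, true], 3, [(0, 0, 1, 2), (0, 0, 2, 1), (0, 1, 1, 1), (0, 1, 2, 0)], [0, 3], 2,
    1, 3⟩,
  ⟨.twist, [false, false, false], 3, [(0, 0, 1, 2), (0, 1, 1, 1), (0, 1, 2, 0), (0, 2, 1, 0),
    (1, 2, 1, 0)], [1, 2, 4, 3, 0], 2, 3, 0⟩,
  ⟨.twist, [false, false, true], 3, [(0, 0, 1, 2), (0, 0, 2, 1), (0, 1, 1, 1), (0, 2, 1, 0),
    (1, 2, 1, 0)], [2, 4, 1, 0, 3], 0, 1, 3⟩,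
  ⟨.twist, [false, true, false], 3, [(0, 0, 1, 2), (0, 1, 1, 1), (0, 1, 2, 0), (0, 2, 1, 0),
    (1, 2, 1, 0)], [4, 2, 1, 0, 4], 3, 1, 4⟩,
  ⟨.twist, [false, true, true], 3, [(0, 0, 1, 2), (0, 0, 2, 1), (0, 1, 1, 1), (0, 1, 2, 0),
    (1, 1, 2, 0)], [3, 4, 0, 1], 2, 3, 1⟩,
  ⟨.twist, [false, false, false, false], 3, [(0, 0, 1, 2), (0, 1, 1, 1), (0, 1, 2, 0),
    (0, 2, 1, 0), (1, 2, 1, 0), (2, 2, 1, 0)], [1, 5, 4, 0, 3, 2], 0, 1, 2⟩,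
  ⟨.twist, [false, true, false, false], 3, [(0, 0, 1, 2), (0, 1, 1, 1), (0, 1, 2, 0),
    (0, 2, 1, 0), (1, 2, 1, 0), (2, 2, 1, 0)], [4, 1, 2, 5, 0, 3], 0, 1, 3⟩,
  ⟨.twist, [false, true, false, true], 3, [(0, 0, 1, 2), (0, 1, 1, 1), (0, 1, 2, 0), (0, 2, 1, 0),
    (1, 2, 1, 0), (2, 2, 1, 0)], [1, 2, 5, 4, 0, 3], 0, 1, 3⟩,
  ⟨.twist, [false, true, true, false], 3, [(0, 0, 1, 2), (0, 0, 2, 1), (0, 1, 1, 1), (0, 1, 2, 0),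
    (1, 1, 2, 0), (2, 1, 2, 0), (3, 1, 1, 1)], [5, 0, 4, 6, 2, 3], 6, 1, 3⟩,
  ⟨.twist, [false, true, true, true], 3, [(0, 0, 1, 2), (0, 0, 2, 1), (0, 1, 1, 1), (0, 1, 2, 0),
    (1, 1, 2, 0), (2, 1, 2, 0)], [4, 3, 0, 5, 2], 5, 1, 2⟩,
  ⟨.twist, [false, true, true, true, false], 3, [(0, 0, 1, 2), (0, 0, 2, 1), (0, 1, 1, 1),
    (0, 2, 1, 0), (1, 2, 1, 0), (2, 2, 1, 0), (3, 2, 1, 0)], [6, 4, 2, 5, 3, 0, 3], 1, 0, 3⟩,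
  ⟨.twist, [false, true, true, true, true], 3, [(0, 0, 1, 2), (0, 0, 2, 1), (0, 1, 2, 0),
    (1, 1, 2, 0), (2, 1, 2, 0), (3, 1, 2, 0)], [5, 0, 3, 4, 1, 2], 1, 0, 2⟩,
  ⟨.ear 0, [false, false, false], 3, [(0, 1, 0, 2), (0, 1, 1, 1), (1, 1, 1, 1), (0, 2, 1, 0),
    (0, 0, 2, 1)], [4, 0, 3, 1, 2], 1, 4, 2⟩,
  ⟨.ear 0, [false, false, true], 3, [(0, 1, 0, 2), (0, 1, 1, 1), (0, 1, 2, 0), (1, 1, 1, 1),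
    (0, 2, 1, 0), (0, 0, 2, 1)], [4, 0, 3, 5, 1], 2, 3, 1⟩,
  ⟨.ear 0, [false, true, false], 3, [(0, 1, 0, 2), (0, 1, 1, 1), (0, 2, 0, 1), (0, 1, 2, 0),
    (0, 0, 1, 2)], [2, 3, 4, 1], 3, 0, 1⟩,
  ⟨.ear 0, [false, true, true], 3, [(0, 1, 1, 1), (0, 2, 0, 1), (0, 1, 2, 0), (0, 0, 1, 2)], [1,
    2, 0, 2], 0, 3, 2⟩,
  ⟨.ear 2, [false, false, true], 3, [(0, 1, 0, 2), (0, 1, 1, 1), (0, 1, 2, 0), (1, 1, 1, 1),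
    (0, 2, 1, 0), (0, 0, 2, 1)], [0, 4, 3, 5, 1], 2, 3, 1⟩,
  ⟨.ear 2, [false, true, true], 3, [(0, 1, 0, 2), (0, 1, 1, 1), (0, 2, 0, 1), (0, 1, 2, 0),
    (0, 0, 1, 2)], [2, 4, 3, 1], 3, 0, 1⟩,
  ⟨.sphere, [false, false], 3, [(0, 1, 0, 2), (0, 1, 1, 1), (0, 0, 2, 1), (1, 1, 1, 1),
    (0, 2, 1, 0)], [4, 0, 2], 3, 1, 0⟩
]

theorem check_table : ∀ c ∈ table, c.check = true := by
  rw [← List.all_eq_true]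
  decide +kernel

end HeavyCertificate

/-! ### Finite models inside of a triangulation -/

open ModelPoint Links

namespace Triangulation

variable {T : Type*}

theorem glue_glue_apply (Δ : Triangulation T) (s : T × Fin 3) : Δ.glue (Δ.glue s) = s :=
  Δ.glue_glue s

theorem not_isBoundary_glue {Δ : Triangulation T} {s : T × Fin 3} (h : ¬ Δ.IsBoundary s) :
    ¬ Δ.IsBoundary (Δ.glue s) := by
  intro hs
  apply h
  rw [IsBoundary, glue_glue_apply] at hs
  exact hs.symm

theorem Glued.symm {Δ : Triangulation T} {k : ℕ} {p q : T × Hive k} (h : Δ.Glued p q) :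
    Δ.Glued q p := by
  obtain ⟨i, j, h1, h2, h3, h4, h5, h6⟩ := h
  refine ⟨j, i, ?_, ?_, h4, h3, h6.symm, h5.symm⟩
  · rw [← h2]; exact not_isBoundary_glue h1
  · rw [← h2, glue_glue_apply]

/-- The vertex `p` is not deleted, when the triangles with a side in `bd` carry `Q_k^1`. -/
def RetainedAt (bd : T × Fin 3 → Prop) {k : ℕ} (p : T × Hive k) : Prop :=
  ∀ j, bd (p.1, j) → p.2.coord (j + 1) ≤ 1 ∨ (p.2.coord j = 0 ∧ p.2.coord (j + 2) ≠ 0)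

/-- The identifications in the triangles which carry `Q_k^1`. -/
def CollapsedAt (bd : T × Fin 3 → Prop) {k : ℕ} (p q : T × Hive k) : Prop :=
  p.1 = q.1 ∧ ∃ j, bd (p.1, j) ∧ p.2.coord (j + 2) ≠ 0 ∧ p.2.coord (j + 1) = 1 ∧
    q.2.coord (j + 2) = p.2.coord (j + 2) ∧ q.2.coord (j + 1) = 1 + p.2.coord j ∧ q.2.coord j = 0

/-- The labels `L` of the vertices of the pieces, with their identifications `r`, in a common
description of both kinds of quivers. The triangles with a side in `bd` carry `Q_k^1`. -/
structure IsLabelling (Δ : Triangulation T) (bd : T × Fin 3 → Prop) {k : ℕ} {L : Type*}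
    (val : L → T × Hive k) (r : L → L → Prop) : Prop where
  injective : val.Injective
  exists_iff : ∀ p, (∃ l, val l = p) ↔ RetainedAt bd p
  rel_iff : ∀ l l', r l l' ↔ Δ.Glued (val l) (val l') ∨ CollapsedAt bd (val l) (val l')
  isBoundary : ∀ s, bd s → Δ.IsBoundary s

/-- The vertices which do not lie on the boundary. -/
abbrev Mutable (Δ : Triangulation T) {k : ℕ} {L : Type*} (val : L → T × Hive k)
    (r : L → L → Prop) : Type _ :=
  {v : Quot r // ∀ l, Quot.mk r l = v → ¬ Δ.OnBoundary (val l)}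

/-- The mutable part of the glued quiver. -/
noncomputable def mutableQuiver (Δ : Triangulation T) {k : ℕ} {L : Type*} (val : L → T × Hive k)
    (r : L → L → Prop) : Matrix (Δ.Mutable val r) (Δ.Mutable val r) ℤ :=
  (gluedQuiver (fun l l' => PieceArrow (val l) (val l')) r).submatrix Subtype.val Subtype.val

theorem isLabelling_fg (Δ : Triangulation T) (k : ℕ) :
    Δ.IsLabelling (fun _ => False) (id : T × Hive k → T × Hive k) Δ.Glued where
  injective := Function.injective_id
  exists_iff p := by simp [RetainedAt]
  rel_iff l l' := by simp [CollapsedAt]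
  isBoundary _ := False.elim

theorem isLabelling_gr (Δ : Triangulation T) (k : ℕ) :
    Δ.IsLabelling Δ.IsBoundary (Subtype.val : Δ.GrPiece k → T × Hive k) Δ.GrGlued where
  injective := Subtype.val_injective
  exists_iff p := ⟨fun ⟨l, hl⟩ => hl ▸ l.2, fun h => ⟨⟨p, h⟩, rfl⟩⟩
  rel_iff _ _ := Iff.rfl
  isBoundary _ := id

theorem mutableQuiver_skew (Δ : Triangulation T) {k : ℕ} {L : Type*} (val : L → T × Hive k)
    (r : L → L → Prop) (u v) : Δ.mutableQuiver val r u v = -Δ.mutableQuiver val r v u := by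
  simp [mutableQuiver, gluedQuiver]

/-- The side of the triangulation which corresponds to a side of the model. -/
def modelSide (t : ℕ → T) (c : ℕ → Fin 3) (s : ℕ × Fin 3) : T × Fin 3 := (t s.1, c s.1 + s.2)

/-- The triangles `t i` with `i < w.length`, rotated by `c i`, form a part of the triangulation
in which the sides are glued as in `K`, while the sides not occurring in `K` are arbitrary.
The coordinates at the corner `0` of the model may be shifted by `d`. -/
structure IsModel (Δ : Triangulation T) (bd : T × Fin 3 → Prop) (d : ℕ) (K : Links)
    (w : List Bool) (t : ℕ → T) (c : ℕ → Fin 3) : Prop where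
  inj : ∀ i < w.length, ∀ j < w.length, t i = t j → i = j
  link : ∀ l ∈ K, l.1.1 < w.length ∧ l.2.1 < w.length ∧ ¬ Δ.IsBoundary (modelSide t c l.1) ∧
    Δ.glue (modelSide t c l.1) = modelSide t c l.2
  letters : ∀ i < w.length, ∀ j, bd (t i, c i + j) ↔ j = 1 ∧ w.getD i false = true
  shift : d = 0 ∨ ∀ l ∈ K, l.1.2 = 0 ∧ l.2.2 = 2

/-- The vertex `p` corresponds to the vertex `P` of the model. -/
def Matches {k : ℕ} (d : ℕ) (t : ℕ → T) (c : ℕ → Fin 3) (P : ModelPoint) (p : T × Hive k) : Prop :=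
  p.1 = t P.1 ∧ ∀ j, p.2.coord (c P.1 + j) = P.cd j + if j = 0 then d else 0

end Triangulation

theorem Hive.sum_coord {k : ℕ} (x : Hive k) (c : Fin 3) :
    x.coord c + x.coord (c + 1) + x.coord (c + 2) = k := by
  have h := x.2
  fin_cases c <;> simp [Hive.coord] at h ⊢ <;> omega

theorem Hive.coord_lt {k : ℕ} (x : Hive k) (c : Fin 3) : x.coord c < k := (x.1 c).2

theorem Hive.ext_coord {k : ℕ} {x y : Hive k} (c : Fin 3)
    (h : ∀ j, x.coord (c + j) = y.coord (c + j)) : x = y := by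
  ext i
  have := h (i - c)
  rw [add_sub_cancel] at this
  exact this

theorem Hive.exists_coord {k : ℕ} (c : Fin 3) (f : Fin 3 → ℕ) (hf : ∀ i, f i < k)
    (hs : f 0 + f 1 + f 2 = k) : ∃ x : Hive k, ∀ j, x.coord (c + j) = f j := by
  refine ⟨⟨fun i => ⟨f (i - c), hf _⟩, ?_⟩, fun j => ?_⟩
  · fin_cases c
    · simpa using hs
    · change f 2 + f 0 + f 1 = k
      omega
    · change f 1 + f 2 + f 0 = k
      omega
  · simp [Hive.coord]

namespace ModelPoint

theorem ext_cd {P Q : ModelPoint} (h : P.1 = Q.1) (hc : ∀ j, P.cd j = Q.cd j) : P = Q :=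
  Prod.ext h (Prod.ext (hc 0) (Prod.ext (hc 1) (hc 2)))

@[simp] theorem rotated_fst (i : ℕ) (j : Fin 3) (a b c : ℕ) : (rotated i j a b c).1 = i := by
  fin_cases j <;> rfl

theorem cd_rotated (i : ℕ) (j : Fin 3) (a b c : ℕ) : (rotated i j a b c).cd j = a := by
  fin_cases j <;> rfl

theorem cd_rotated_one (i : ℕ) (j : Fin 3) (a b c : ℕ) : (rotated i j a b c).cd (j + 1) = b := by
  fin_cases j <;> rfl

theorem cd_rotated_two (i : ℕ) (j : Fin 3) (a b c : ℕ) : (rotated i j a b c).cd (j + 2) = c := by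
  fin_cases j <;> rfl

end ModelPoint

theorem Links.partner_eq_some {K : Links} {s s' : ℕ × Fin 3} (h : K.partner s = some s') :
    (s, s') ∈ K ∨ (s', s) ∈ K := by
  obtain ⟨l, hl, hs⟩ := List.exists_of_findSome?_eq_some h
  clear h
  split_ifs at hs with h1 h2
  · left
    obtain rfl := h1
    obtain rfl := Option.some.inj hs
    exact hl
  · right
    obtain rfl := h2
    obtain rfl := Option.some.inj hs
    exact hl

namespace Triangulation

variable {T : Type*} {Δ : Triangulation T} {bd : T × Fin 3 → Prop} {k d : ℕ} {K : Links}
  {w : List Bool} {t : ℕ → T} {c : ℕ → Fin 3}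

/-- Conditions on a vertex of the model. -/
structure IsValid (k d : ℕ) (w : List Bool) (P : ModelPoint) : Prop where
  lt : P.1 < w.length
  sum : P.2.1 + P.2.2.1 + P.2.2.2 + d = k
  bound : ∀ j, P.cd j + d < k
  apex : d = 0 ∨ 1 ≤ P.2.1

theorem IsValid.exists_matches {P : ModelPoint} (hP : IsValid k d w P) (t : ℕ → T)
    (c : ℕ → Fin 3) : ∃ p : T × Hive k, Matches d t c P p := by
  obtain ⟨x, hx⟩ := Hive.exists_coord (k := k) (c P.1) (fun j => P.cd j + if j = 0 then d else 0)
    (fun j => lt_of_le_of_lt (by split_ifs <;> simp) (hP.bound j))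
    (by have := hP.sum; simp [ModelPoint.cd]; omega)
  exact ⟨(t P.1, x), rfl, hx⟩

theorem Matches.unique {P : ModelPoint} {p q : T × Hive k} (hp : Matches d t c P p)
    (hq : Matches d t c P q) : p = q :=
  Prod.ext (hp.1.trans hq.1.symm)
    (Hive.ext_coord (c P.1) fun j => (hp.2 j).trans (hq.2 j).symm)

theorem IsModel.matches_inj (hM : Δ.IsModel bd d K w t c) {P Q : ModelPoint} {p : T × Hive k}
    (hP : P.1 < w.length) (hQ : Q.1 < w.length) (hp : Matches d t c P p)
    (hq : Matches d t c Q p) : P = Q := by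
  have h := hM.inj _ hP _ hQ (hp.1.symm.trans hq.1)
  refine ModelPoint.ext_cd h fun j => ?_
  have h1 := hp.2 j
  have h2 := hq.2 j
  rw [h] at h1
  omega

theorem Matches.coord_zero {P : ModelPoint} {p : T × Hive k} (h : Matches d t c P p) :
    p.2.coord (c P.1) = P.2.1 + d := by simpa [ModelPoint.cd] using h.2 0

theorem Matches.coord_one {P : ModelPoint} {p : T × Hive k} (h : Matches d t c P p) :
    p.2.coord (c P.1 + 1) = P.2.2.1 := by simpa [ModelPoint.cd] using h.2 1

theorem Matches.coord_two {P : ModelPoint} {p : T × Hive k} (h : Matches d t c P p) :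
    p.2.coord (c P.1 + 2) = P.2.2.2 := by simpa [ModelPoint.cd] using h.2 2

theorem IsModel.retainedAt_iff (hM : Δ.IsModel bd d K w t c) {P : ModelPoint} {p : T × Hive k}
    (hP : P.1 < w.length) (ha : d = 0 ∨ 1 ≤ P.2.1) (hp : Matches d t c P p) :
    RetainedAt bd p ↔ ModelPoint.retained w P = true := by
  have h0 := hp.coord_zero
  have h1 := hp.coord_one
  have h2 := hp.coord_two
  have e : c P.1 + 1 + 1 = c P.1 + 2 := by rw [add_assoc]; rfl
  have e' : c P.1 + 1 + 2 = c P.1 := by rw [add_assoc]; exact add_zero _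
  have key : RetainedAt bd p ↔ (w.getD P.1 false = true →
      p.2.coord (c P.1 + 1 + 1) ≤ 1 ∨
        (p.2.coord (c P.1 + 1) = 0 ∧ p.2.coord (c P.1 + 1 + 2) ≠ 0)) := by
    constructor
    · intro h hw
      exact h _ (by rw [hp.1]; exact (hM.letters _ hP 1).2 ⟨rfl, hw⟩)
    · intro h j hj
      rw [hp.1, ← add_sub_cancel (c P.1) j] at hj
      obtain ⟨hj1, hw⟩ := (hM.letters _ hP _).1 hj
      have : j = c P.1 + 1 := by rw [← hj1, add_sub_cancel]
      subst this
      exact h hw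
  rw [key, e, e', h0, h1, h2]
  simp only [ModelPoint.retained, Bool.or_eq_true, Bool.and_eq_true, Bool.not_eq_true',
    decide_eq_true_eq, beq_iff_eq, bne_iff_ne, ne_eq, or_assoc]
  rcases Bool.eq_false_or_eq_true (w.getD P.1 false) with hw | hw <;> rw [hw] <;> (simp; try omega)

theorem IsModel.pieceArrow_iff (hM : Δ.IsModel bd d K w t c) {P Q : ModelPoint}
    {p q : T × Hive k} (hP : IsValid k d w P) (hQ : IsValid k d w Q) (hp : Matches d t c P p)
    (hq : Matches d t c Q q) : PieceArrow p q ↔ ModelPoint.arrow P Q = true := by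
  have key : PieceArrow p q ↔ P.1 = Q.1 ∧ p.2.Arrow q.2 := by
    rw [PieceArrow, hp.1, hq.1]
    exact and_congr_left' ⟨hM.inj _ hP.lt _ hQ.lt, congrArg t⟩
  rw [key]
  simp only [ModelPoint.arrow, Bool.and_eq_true, beq_iff_eq]
  refine and_congr_right fun hPQ => ?_
  have p0 := hp.coord_zero
  have p1 := hp.coord_one
  have p2 := hp.coord_two
  have q0 := hq.coord_zero
  have q1 := hq.coord_one
  have q2 := hq.coord_two
  rw [← hPQ] at q0 q1 q2
  have hrot : p.2.Arrow q.2 ↔ ∃ j : Fin 3, 1 ≤ p.2.coord (c P.1 + j) ∧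
      q.2.coord (c P.1 + j) = p.2.coord (c P.1 + j) ∧
      q.2.coord (c P.1 + j + 1) = p.2.coord (c P.1 + j + 1) + 1 ∧
      p.2.coord (c P.1 + j + 2) = q.2.coord (c P.1 + j + 2) + 1 :=
    ⟨fun ⟨i, hi⟩ => ⟨i - c P.1, by rwa [add_sub_cancel]⟩, fun ⟨j, hj⟩ => ⟨_, hj⟩⟩
  have e1 : c P.1 + 1 + 1 = c P.1 + 2 := by rw [add_assoc]; rfl
  have e2 : c P.1 + 1 + 2 = c P.1 := by rw [add_assoc]; exact add_zero _
  have e3 : c P.1 + 2 + 1 = c P.1 := by rw [add_assoc]; exact add_zero _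
  have e4 : c P.1 + 2 + 2 = c P.1 + 1 := by rw [add_assoc]; rfl
  rw [hrot, Fin.exists_fin_succ, Fin.exists_fin_two]
  simp only [Fin.succ_zero_eq_one, Fin.succ_one_eq_two, add_zero, e1, e2, e3, e4, p0, p1, p2, q0,
    q1, q2, Bool.or_eq_true, Bool.and_eq_true, beq_iff_eq, decide_eq_true_eq]
  have := hP.apex
  omega

theorem _root_.Links.mem_collapse {w : List Bool} {P Q : ModelPoint} :
    Q ∈ collapse w P ↔ (w.getD P.1 false = true ∧ P.2.1 ≠ 0) ∧
      ((P.2.2.2 = 1 ∧ Q = (P.1, P.2.1, 0, 1 + P.2.2.1)) ∨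
        ((P.2.2.1 = 0 ∧ 1 ≤ P.2.2.2) ∧ Q = (P.1, P.2.1, P.2.2.2 - 1, 1))) := by
  by_cases hw : w.getD P.1 false = true ∧ P.2.1 ≠ 0
  · rw [collapse, if_pos hw]
    simp only [List.mem_append, List.mem_ite_nil_right, List.mem_singleton]
    tauto
  · rw [collapse, if_neg hw]
    exact ⟨fun h => absurd h (List.not_mem_nil), fun h => absurd h.1 hw⟩

theorem IsModel.partner (hM : Δ.IsModel bd d K w t c) {s s' : ℕ × Fin 3}
    (h : K.partner s = some s') :
    s'.1 < w.length ∧ ¬ Δ.IsBoundary (modelSide t c s) ∧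
      Δ.glue (modelSide t c s) = modelSide t c s' ∧
      (d = 0 ∨ (s.2 = 0 ∧ s'.2 = 2) ∨ (s.2 = 2 ∧ s'.2 = 0)) := by
  rcases partner_eq_some h with h | h
  · obtain ⟨-, h2, h3, h4⟩ := hM.link _ h
    exact ⟨h2, h3, h4, hM.shift.imp_right fun h' => .inl (h' _ h)⟩
  · obtain ⟨h1, -, h3, h4⟩ := hM.link _ h
    refine ⟨h1, ?_, ?_, hM.shift.imp_right fun h' => .inr (h' _ h).symm⟩
    · have := not_isBoundary_glue h3
      rwa [h4] at this
    · change Δ.glue (modelSide t c s') = _ at h4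
      rw [← h4, glue_glue_apply]

theorem forall_fin_three_of_rotate {p : Fin 3 → Prop} (s : Fin 3) (h0 : p s) (h1 : p (s + 1))
    (h2 : p (s + 2)) (j : Fin 3) : p j := by
  have : j = s ∨ j = s + 1 ∨ j = s + 2 := by
    clear h0 h1 h2
    revert j s
    decide
  rcases this with rfl | rfl | rfl <;> assumption

theorem Matches.coord_eq_zero_iff {P : ModelPoint} {p : T × Hive k} (hP : IsValid k d w P)
    (hp : Matches d t c P p) (j : Fin 3) : p.2.coord (c P.1 + j) = 0 ↔ P.cd j = 0 := by
  rw [hp.2 j]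
  split_ifs with h
  · subst h
    have := hP.apex
    simp only [ModelPoint.cd]
    omega
  · simp

/-- The shift of the coordinates is compatible with the gluing. -/
theorem shift_eq {a b : Fin 3} (h : d = 0 ∨ (a = 0 ∧ b = 2) ∨ (a = 2 ∧ b = 0)) :
    (if a + 1 = 0 then d else 0) = (if b = 0 then d else 0) ∧
      (if a = 0 then d else 0) = (if b + 1 = 0 then d else 0) ∧
      (if a + 2 = 0 then d else 0) = 0 ∧ (if b + 2 = 0 then d else 0) = 0 := by
  rcases h with rfl | ⟨rfl, rfl⟩ | ⟨rfl, rfl⟩ <;> simp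

theorem IsModel.exists_mirror (hM : Δ.IsModel bd d K w t c) {P : ModelPoint} {p q : T × Hive k}
    (hP : IsValid k d w P) (hp : Matches d t c P p)
    (hK : ∀ j, P.cd (j + 2) = 0 → (K.partner (P.1, j)).isSome) (h : Δ.Glued p q) :
    ∃ Q ∈ K.mirror P, Matches d t c Q q := by
  obtain ⟨i, j, -, h2, h3, h4, h5, h6⟩ := h
  obtain ⟨a, rfl⟩ : ∃ a, i = c P.1 + a := ⟨i - c P.1, by rw [add_sub_cancel]⟩
  have ha : P.cd (a + 2) = 0 := by
    rw [← hp.coord_eq_zero_iff hP, ← add_assoc]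
    exact h3
  obtain ⟨s, hs⟩ := Option.isSome_iff_exists.1 (hK a ha)
  obtain ⟨-, -, hg, hd⟩ := hM.partner hs
  rw [hp.1] at h2
  rw [modelSide, h2, modelSide, Prod.mk.injEq] at hg
  obtain ⟨hq, rfl⟩ := hg
  refine ⟨rotated s.1 s.2 (P.cd (a + 1)) (P.cd a) 0, ?_, ?_, ?_⟩
  · rw [mirror, List.mem_flatMap]
    refine ⟨a, by fin_cases a <;> simp, ?_⟩
    rw [if_pos ha, hs]
    simp
  · rw [rotated_fst, hq]
  · obtain ⟨e1, e2, e3, e4⟩ := shift_eq hd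
    rw [rotated_fst]
    refine forall_fin_three_of_rotate s.2 ?_ ?_ ?_
    · rw [cd_rotated, h6, add_assoc, hp.2]
      exact congrArg _ e1
    · rw [cd_rotated_one, ← add_assoc, h5, hp.2]
      exact congrArg _ e2
    · rw [cd_rotated_two, ← add_assoc, e4]
      exact h4

theorem IsModel.glued_of_mem_mirror (hM : Δ.IsModel bd d K w t c) {P Q : ModelPoint}
    {p q : T × Hive k} (hP : IsValid k d w P) (hp : Matches d t c P p) (hq : Matches d t c Q q)
    (h : Q ∈ K.mirror P) : Δ.Glued p q := by
  rw [mirror, List.mem_flatMap] at h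
  obtain ⟨a, -, h⟩ := h
  split_ifs at h with ha
  · split at h
    · simp at h
    · rename_i s hs
      rw [List.mem_singleton] at h
      subst h
      obtain ⟨-, hb, hg, hd⟩ := hM.partner hs
      obtain ⟨e1, e2, e3, e4⟩ := shift_eq hd
      obtain ⟨hq1, hq2⟩ := hq
      rw [rotated_fst] at hq1 hq2
      refine ⟨c P.1 + a, c s.1 + s.2, ?_, ?_, ?_, ?_, ?_, ?_⟩
      · rw [hp.1]; exact hb
      · rw [hp.1, hq1]; exact hg
      · have := (hp.coord_eq_zero_iff hP (a + 2)).2 ha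
        rwa [← add_assoc] at this
      · have := hq2 (s.2 + 2)
        rw [cd_rotated_two, e4, ← add_assoc] at this
        exact this
      · rw [add_assoc, hq2, cd_rotated_one, hp.2, e2]
      · rw [hq2, cd_rotated, add_assoc, hp.2, e1]
  · simp at h

theorem IsModel.exists_collapse (hM : Δ.IsModel bd d K w t c) {P : ModelPoint} {p q : T × Hive k}
    (hP : IsValid k d w P) (hp : Matches d t c P p)
    (h : CollapsedAt bd p q ∨ CollapsedAt bd q p) :
    ∃ Q ∈ collapse w P, Matches d t c Q q := by
  have p0 := hp.coord_zero
  have p1 := hp.coord_one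
  have p2 := hp.coord_two
  have ha := hP.apex
  have e1 : c P.1 + 1 + 1 = c P.1 + 2 := by rw [add_assoc]; rfl
  have e2 : c P.1 + 1 + 2 = c P.1 := by rw [add_assoc]; exact add_zero _
  have hj : ∀ j, bd (t P.1, j) → j = c P.1 + 1 ∧ w.getD P.1 false = true := by
    intro j hj
    rw [← add_sub_cancel (c P.1) j] at hj
    obtain ⟨hj1, hw⟩ := (hM.letters _ hP.lt _).1 hj
    exact ⟨by rw [← hj1, add_sub_cancel], hw⟩
  rcases h with ⟨h1, j, h2, h3, h4, h5, h6, h7⟩ | ⟨h1, j, h2, h3, h4, h5, h6, h7⟩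
  · rw [hp.1] at h2
    obtain ⟨rfl, hw⟩ := hj j h2
    rw [e2] at h3 h5
    rw [e1] at h4 h6
    refine ⟨(P.1, P.2.1, 0, 1 + P.2.2.1), ?_, h1.symm.trans hp.1, ?_⟩
    · rw [collapse, if_pos ⟨hw, by omega⟩, if_pos (by omega)]
      simp
    · intro b
      fin_cases b <;> simp [ModelPoint.cd] <;> omega
  · rw [h1, hp.1] at h2
    obtain ⟨rfl, hw⟩ := hj j h2
    rw [e2] at h3 h5
    rw [e1] at h4 h6
    refine ⟨(P.1, P.2.1, P.2.2.2 - 1, 1), ?_, h1.trans hp.1, ?_⟩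
    · rw [collapse, if_pos ⟨hw, by omega⟩, List.mem_append]
      right
      rw [if_pos (by omega)]
      simp
    · intro b
      fin_cases b <;> simp [ModelPoint.cd] <;> omega

theorem IsModel.collapsedAt_of_mem_collapse (hM : Δ.IsModel bd d K w t c) {P Q : ModelPoint}
    {p q : T × Hive k} (hP : IsValid k d w P) (hp : Matches d t c P p) (hq : Matches d t c Q q)
    (h : Q ∈ collapse w P) : CollapsedAt bd p q ∨ CollapsedAt bd q p := by
  have p0 := hp.coord_zero
  have p1 := hp.coord_one
  have p2 := hp.coord_two
  have q0 := hq.coord_zero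
  have q1 := hq.coord_one
  have q2 := hq.coord_two
  have e1 : c P.1 + 1 + 1 = c P.1 + 2 := by rw [add_assoc]; rfl
  have e2 : c P.1 + 1 + 2 = c P.1 := by rw [add_assoc]; exact add_zero _
  rw [mem_collapse] at h
  obtain ⟨hw, h⟩ := h
  have hb := (hM.letters _ hP.lt 1).2 ⟨rfl, hw.1⟩
  rcases h with ⟨h1, rfl⟩ | ⟨h1, rfl⟩ <;> simp only at q0 q1 q2
  · left
    refine ⟨hp.1.trans hq.1.symm, c P.1 + 1, by rw [hp.1]; exact hb, ?_⟩
    rw [e1, e2]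
    omega
  · right
    refine ⟨hq.1.trans hp.1.symm, c P.1 + 1, by rw [hq.1]; exact hb, ?_⟩
    rw [e1, e2]
    omega

theorem IsModel.valid_of_mem (hM : Δ.IsModel bd d K w t c) {P Q : ModelPoint}
    (hP : IsValid k d w P) (h : Q ∈ K.mirror P ++ collapse w P) :
    Q.1 < w.length ∧ (d = 0 ∨ 1 ≤ Q.2.1) := by
  rw [List.mem_append] at h
  rcases h with h | h
  · rw [mirror, List.mem_flatMap] at h
    obtain ⟨a, -, h⟩ := h
    split_ifs at h with ha
    · split at h
      · simp at h
      · rename_i s hs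
        rw [List.mem_singleton] at h
        subst h
        obtain ⟨h1, -, -, hd⟩ := hM.partner hs
        refine ⟨by rwa [rotated_fst], ?_⟩
        rcases hd with hd | ⟨h2, h3⟩ | ⟨h2, h3⟩
        · exact .inl hd
        all_goals
          simp only at h2
          rw [h2, h3]
          exact hP.apex
    · simp at h
  · obtain ⟨-, ⟨-, rfl⟩ | ⟨-, rfl⟩⟩ := mem_collapse.1 h <;> exact ⟨hP.lt, hP.apex⟩

end Triangulation

namespace Links

theorem mem_foldl_insert {α : Type*} [BEq α] [LawfulBEq α] (A C : List α) (Q : α) :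
    Q ∈ A.foldl (fun C Q => C.insert Q) C ↔ Q ∈ A ∨ Q ∈ C := by
  induction A generalizing C with
  | nil => simp
  | cons a A ih =>
    rw [List.foldl_cons, ih]
    simp only [List.mem_insert_iff, List.mem_cons]
    tauto

theorem subset_saturate (K : Links) (w : List Bool) (n : ℕ) (C : List ModelPoint) :
    C ⊆ K.saturate w n C := by
  induction n generalizing C with
  | zero => exact fun _ h => h
  | succ n ih => exact fun P hP => ih _ ((mem_foldl_insert _ _ _).2 (.inr hP))

theorem saturate_induction {K : Links} {w : List Bool} {p : ModelPoint → Prop} (n : ℕ)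
    (C : List ModelPoint) (h : ∀ P ∈ C, p P)
    (hp : ∀ P ∈ K.saturate w n C, p P → ∀ Q ∈ K.moves w P, p Q) :
    ∀ P ∈ K.saturate w n C, p P := by
  induction n generalizing C with
  | zero => exact h
  | succ n ih =>
    refine ih _ (fun Q hQ => ?_) hp
    rcases (mem_foldl_insert _ _ _).1 hQ with hQ | hQ
    · obtain ⟨P, hP, hQ⟩ := List.mem_flatMap.1 hQ
      exact hp P (K.subset_saturate w (n + 1) C hP) (h P hP) Q hQ
    · exact h Q hQ

end Links

namespace Triangulation

variable {T : Type*} {Δ : Triangulation T} {bd : T × Fin 3 → Prop} {k k₀ d : ℕ} {K : Links}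
  {w : List Bool} {t : ℕ → T} {c : ℕ → Fin 3} {L : Type*} {val : L → T × Hive k}
  {r : L → L → Prop}

/-- What the computation `Links.closedClass` verifies. -/
structure IsClosedClass (k d : ℕ) (K : Links) (w : List Bool) (C : List ModelPoint) : Prop where
  valid : ∀ P ∈ C, IsValid k d w P
  retained : ∀ P ∈ C, retained w P = true
  linked : ∀ P ∈ C, ∀ j, P.cd (j + 2) = 0 → (K.partner (P.1, j)).isSome
  moves : ∀ P ∈ C, ∀ Q ∈ K.moves w P, Q ∈ C

theorem isClosedClass_of_check {apex : Bool} {C : List ModelPoint}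
    (h : K.closedClass w k₀ apex C = true) (hd : d = 0 ∨ apex = true) :
    IsClosedClass (k₀ + d) d K w C := by
  simp only [closedClass, List.all_eq_true, Bool.and_eq_true, decide_eq_true_eq, beq_iff_eq,
    Bool.or_eq_true, Bool.not_eq_true', bne_iff_ne, ne_eq, List.contains_iff_mem] at h
  refine ⟨fun P hP => ?_, fun P hP => ?_, fun P hP j hj => ?_, fun P hP => ?_⟩
  · obtain ⟨⟨⟨⟨⟨⟨⟨⟨h1, h2⟩, h3⟩, h4⟩, h5⟩, h6⟩, -⟩, -⟩, -⟩ := h P hP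
    refine ⟨h1, by omega, ?_, ?_⟩
    · rw [Fin.forall_fin_succ, Fin.forall_fin_two]
      simp only [Fin.succ_zero_eq_one, Fin.succ_one_eq_two, cd]
      omega
    · rcases hd with hd | hd
      · exact .inl hd
      · exact .inr (h6.resolve_left (by simp [hd]))
  · exact (h P hP).1.1.2
  · exact ((h P hP).1.2 j (by fin_cases j <;> simp)).resolve_left (not_not.2 hj)
  · exact (h P hP).2

theorem IsModel.exists_moves (hM : Δ.IsModel bd d K w t c) (hL : Δ.IsLabelling bd val r)
    {P : ModelPoint} {l l' : L} (hP : IsValid k d w P) (hl : Matches d t c P (val l))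
    (hK : ∀ j, P.cd (j + 2) = 0 → (K.partner (P.1, j)).isSome) (h : r l l' ∨ r l' l) :
    ∃ Q ∈ K.moves w P, Matches d t c Q (val l') := by
  have key : ∃ Q ∈ K.mirror P ++ collapse w P, Matches d t c Q (val l') := by
    have h' : Δ.Glued (val l) (val l') ∨
        (CollapsedAt bd (val l) (val l') ∨ CollapsedAt bd (val l') (val l)) := by
      rcases h with h | h <;> rcases (hL.rel_iff _ _).1 h with h | h
      · exact .inl h
      · exact .inr (.inl h)
      · exact .inl h.symm
      · exact .inr (.inr h)
    rcases h' with h' | h'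
    · obtain ⟨Q, hQ, hm⟩ := hM.exists_mirror hP hl hK h'
      exact ⟨Q, List.mem_append_left _ hQ, hm⟩
    · obtain ⟨Q, hQ, hm⟩ := hM.exists_collapse hP hl h'
      exact ⟨Q, List.mem_append_right _ hQ, hm⟩
  obtain ⟨Q, hQ, hm⟩ := key
  obtain ⟨h1, h2⟩ := hM.valid_of_mem hP hQ
  exact ⟨Q, List.mem_filter.2 ⟨hQ, (hM.retainedAt_iff h1 h2 hm).1 ((hL.exists_iff _).1 ⟨l', rfl⟩)⟩,
    hm⟩

theorem IsModel.mk_eq_of_mem_moves (hM : Δ.IsModel bd d K w t c) (hL : Δ.IsLabelling bd val r)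
    {P Q : ModelPoint} {l l' : L} (hP : IsValid k d w P) (hl : Matches d t c P (val l))
    (hl' : Matches d t c Q (val l')) (h : Q ∈ K.moves w P) : Quot.mk r l = Quot.mk r l' := by
  rcases List.mem_append.1 (List.mem_filter.1 h).1 with h | h
  · exact Quot.sound ((hL.rel_iff _ _).2 (.inl (hM.glued_of_mem_mirror hP hl hl' h)))
  · rcases hM.collapsedAt_of_mem_collapse hP hl hl' h with h | h
    · exact Quot.sound ((hL.rel_iff _ _).2 (.inr h))
    · exact (Quot.sound ((hL.rel_iff _ _).2 (.inr h))).symm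

theorem IsModel.exists_label (hM : Δ.IsModel bd d K w t c) (hL : Δ.IsLabelling bd val r)
    {C : List ModelPoint} (hC : IsClosedClass k d K w C) {P : ModelPoint} (hP : P ∈ C) :
    ∃ l, Matches d t c P (val l) := by
  obtain ⟨p, hp⟩ := (hC.valid P hP).exists_matches t c
  obtain ⟨l, rfl⟩ := (hL.exists_iff p).2
    ((hM.retainedAt_iff (hC.valid P hP).lt (hC.valid P hP).apex hp).2 (hC.retained P hP))
  exact ⟨l, hp⟩

theorem IsModel.exists_class (hM : Δ.IsModel bd d K w t c) (hL : Δ.IsLabelling bd val r)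
    {n : ℕ} {P : ModelPoint} (hC : IsClosedClass k d K w (K.saturate w n [P])) :
    ∃ v : Δ.Mutable val r,
      ∀ l, Quot.mk r l = v.1 ↔ ∃ Q ∈ K.saturate w n [P], Matches d t c Q (val l) := by
  set C := K.saturate w n [P] with hCdef
  have hPC : P ∈ C := K.subset_saturate w n [P] (by simp)
  obtain ⟨l₀, hl₀⟩ := hM.exists_label hL hC hPC
  have key : ∀ l, Quot.mk r l = Quot.mk r l₀ ↔ ∃ Q ∈ C, Matches d t c Q (val l) := by
    intro l
    constructor
    · intro h
      have hr : ∀ l l', r l l' → (∃ Q ∈ C, Matches d t c Q (val l)) =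
          (∃ Q ∈ C, Matches d t c Q (val l')) := by
        refine fun l l' hll => propext ⟨?_, ?_⟩
        · rintro ⟨Q, hQ, hm⟩
          obtain ⟨Q', hQ', hm'⟩ :=
            hM.exists_moves hL (hC.valid Q hQ) hm (hC.linked Q hQ) (.inl hll)
          exact ⟨Q', hC.moves Q hQ Q' hQ', hm'⟩
        · rintro ⟨Q, hQ, hm⟩
          obtain ⟨Q', hQ', hm'⟩ :=
            hM.exists_moves hL (hC.valid Q hQ) hm (hC.linked Q hQ) (.inr hll)
          exact ⟨Q', hC.moves Q hQ Q' hQ', hm'⟩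
      have := congrArg (Quot.lift (fun l => ∃ Q ∈ C, Matches d t c Q (val l)) hr) h
      exact this.mpr ⟨P, hPC, hl₀⟩
    · rintro ⟨Q, hQ, hm⟩
      have := saturate_induction (K := K) (w := w)
        (p := fun Q => ∀ l, Matches d t c Q (val l) → Quot.mk r l = Quot.mk r l₀) n [P]
        (fun Q hQ l hl => ?_) (fun Q hQ ih Q' hQ' l hl => ?_) Q hQ l hm
      · exact this
      · rw [List.mem_singleton] at hQ
        subst hQ
        rw [hL.injective (hl.unique hl₀)]
      · obtain ⟨l', hl'⟩ := hM.exists_label hL hC hQ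
        rw [← ih l' hl']
        exact (hM.mk_eq_of_mem_moves hL (hC.valid Q hQ) hl' hl hQ').symm
  refine ⟨⟨Quot.mk r l₀, fun l hl => ?_⟩, key⟩
  obtain ⟨Q, hQ, hm⟩ := (key l).1 hl
  rintro ⟨i, h1, h2⟩
  obtain ⟨a, rfl⟩ : ∃ a, i = c Q.1 + a := ⟨i - c Q.1, by rw [add_sub_cancel]⟩
  rw [OnSide, add_assoc, hm.coord_eq_zero_iff (hC.valid Q hQ)] at h2
  obtain ⟨s, hs⟩ := Option.isSome_iff_exists.1 (hC.linked Q hQ a h2)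
  rw [hm.1] at h1
  exact (hM.partner hs).2.1 h1

theorem IsModel.ncard_arrows (hM : Δ.IsModel bd d K w t c) (hL : Δ.IsLabelling bd val r)
    {C C' : List ModelPoint} (hC : IsClosedClass k d K w C) (hC' : IsClosedClass k d K w C')
    (hn : C.Nodup) (hn' : C'.Nodup) {u v : Quot r}
    (hu : ∀ l, Quot.mk r l = u ↔ ∃ Q ∈ C, Matches d t c Q (val l))
    (hv : ∀ l, Quot.mk r l = v ↔ ∃ Q ∈ C', Matches d t c Q (val l)) :
    Set.ncard {p : L × L | PieceArrow (val p.1) (val p.2) ∧ Quot.mk r p.1 = u ∧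
      Quot.mk r p.2 = v} = ((C.product C').filter fun q => arrow q.1 q.2).length := by
  have hex : ∀ P, (P ∈ C ∨ P ∈ C') → ∃ l, Matches d t c P (val l) := fun P hP =>
    hP.elim (hM.exists_label hL hC) (hM.exists_label hL hC')
  obtain ⟨l₀, -⟩ := u.exists_rep
  have : Nonempty L := ⟨l₀⟩
  choose! e he using hex
  set A := (C.product C').filter fun q => arrow q.1 q.2 with hA
  have hmem : ∀ q, q ∈ A ↔ (q.1 ∈ C ∧ q.2 ∈ C') ∧ arrow q.1 q.2 = true := fun q => by
    rw [hA, List.mem_filter]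
    exact and_congr_left' (List.mem_product (a := q.1) (b := q.2))
  have hAn : A.Nodup := (hn.product hn').filter _
  rw [← List.toFinset_card_of_nodup hAn, ← Set.ncard_coe_finset]
  rw [← Set.InjOn.ncard_image (f := fun q : ModelPoint × ModelPoint => (e q.1, e q.2))]
  · congr 1
    ext ⟨l, l'⟩
    simp only [Set.mem_ofPred_eq, Set.mem_image, List.coe_toFinset, hmem]
    rw [hu, hv]
    constructor
    · rintro ⟨h1, ⟨P, hP, hl⟩, ⟨Q, hQ, hl'⟩⟩
      exact ⟨(P, Q), ⟨⟨hP, hQ⟩, (hM.pieceArrow_iff (hC.valid P hP) (hC'.valid Q hQ) hl hl').1 h1⟩,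
        Prod.ext (hL.injective ((he P (.inl hP)).unique hl))
          (hL.injective ((he Q (.inr hQ)).unique hl'))⟩
    · rintro ⟨⟨P, Q⟩, ⟨⟨hP, hQ⟩, h1⟩, heq⟩
      obtain ⟨rfl, rfl⟩ := Prod.mk.inj heq
      have h2 := he P (.inl hP)
      have h3 := he Q (.inr hQ)
      exact ⟨(hM.pieceArrow_iff (hC.valid P hP) (hC'.valid Q hQ) h2 h3).2 h1, ⟨P, hP, h2⟩,
        ⟨Q, hQ, h3⟩⟩
  · rintro ⟨P, Q⟩ hq ⟨P', Q'⟩ hq' h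
    simp only [List.coe_toFinset, Set.mem_ofPred_eq, hmem] at hq hq'
    replace h := Prod.mk.inj h
    obtain ⟨⟨hP, hQ⟩, -⟩ := hq
    obtain ⟨⟨hP', hQ'⟩, -⟩ := hq'
    have h1 := he P (.inl hP)
    have h2 := he Q (.inr hQ)
    rw [h.1] at h1
    rw [h.2] at h2
    rw [hM.matches_inj (hC.valid P hP).lt (hC.valid P' hP').lt h1 (he P' (.inl hP')),
      hM.matches_inj (hC'.valid Q hQ).lt (hC'.valid Q' hQ').lt h2 (he Q' (.inr hQ'))]

/-- The vertices of a finite model form a full subquiver. -/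
theorem IsModel.exists_embedding (hM : Δ.IsModel bd d K w t c) (hL : Δ.IsLabelling bd val r)
    (hk : k = k₀ + d) {apex : Bool} (hd : d = 0 ∨ apex = true) {V : List ModelPoint}
    (hV : K.independent w k₀ apex V = true) :
    ∃ f : Fin V.length → Δ.Mutable val r, f.Injective ∧
      ((Δ.mutableQuiver val r).submatrix f f).HasRows (K.rows w V) ∧
      ∀ a l, Quot.mk r l = (f a).1 ↔
        ∃ Q ∈ K.saturate w 2 [V[a]], Matches d t c Q (val l) := by
  subst hk
  simp only [independent, Bool.and_eq_true, List.all_eq_true, decide_eq_true_eq] at hV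
  obtain ⟨hV, hpw⟩ := hV
  have hcl : ∀ a : Fin V.length, IsClosedClass (k₀ + d) d K w (K.saturate w 2 [V[a]]) ∧
      (K.saturate w 2 [V[a]]).Nodup := fun a => by
    obtain ⟨h1, h2⟩ := hV _ (List.mem_map.2 ⟨V[a], List.getElem_mem _, rfl⟩)
    exact ⟨isClosedClass_of_check h1 hd, h2⟩
  choose f hf using fun a => hM.exists_class hL (hcl a).1
  refine ⟨f, ?_, ?_, hf⟩
  · have hlt : ∀ a b : Fin V.length, a < b → f a ≠ f b := by
      intro a b hab h
      have hPa : V[a] ∈ K.saturate w 2 [V[a]] := K.subset_saturate w 2 _ (by simp)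
      obtain ⟨l, hl⟩ := hM.exists_label hL (hcl a).1 hPa
      have h1 := (hf a l).2 ⟨_, hPa, hl⟩
      rw [h] at h1
      obtain ⟨Q, hQ, hm⟩ := (hf b l).1 h1
      have := hM.matches_inj ((hcl a).1.valid _ hPa).lt ((hcl b).1.valid _ hQ).lt hl hm
      rw [classes, List.pairwise_map, List.pairwise_iff_getElem] at hpw
      exact hpw a b a.2 b.2 hab _ hPa (this ▸ hQ)
    intro a b h
    rcases lt_trichotomy a b with hab | hab | hab
    · exact absurd h (hlt a b hab)
    · exact hab
    · exact absurd h.symm (hlt b a hab)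
  · rw [Matrix.HasRows]
    have hent : ∀ a b : Fin V.length, Δ.mutableQuiver val r (f a) (f b) =
        arrows (K.saturate w 2 [V[a]]) (K.saturate w 2 [V[b]]) := by
      intro a b
      simp only [mutableQuiver, gluedQuiver, Matrix.submatrix_apply, Matrix.of_apply, arrows]
      have e1 := hM.ncard_arrows hL (hcl a).1 (hcl b).1 (hcl a).2 (hcl b).2 (hf a) (hf b)
      have e2 := hM.ncard_arrows hL (hcl b).1 (hcl a).1 (hcl b).2 (hcl a).2 (hf b) (hf a)
      rw [e1, e2]
    apply List.ext_getElem
    · simp [rows, classes]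
    · intro i h1 h2
      apply List.ext_getElem
      · simp [rows, classes]
      · intro j h3 h4
        have hi : i < V.length := by simpa using h2
        have hj : j < V.length := by simpa using h4
        have := hent ⟨i, hi⟩ ⟨j, hj⟩
        simpa [rows, classes] using this.symm

end Triangulation

namespace HeavyCertificate

open Triangulation

variable {T : Type*} {Δ : Triangulation T} {bd : T × Fin 3 → Prop} {k d : ℕ}
  {t : ℕ → T} {c : ℕ → Fin 3} {L : Type*} {val : L → T × Hive k} {r : L → L → Prop}

theorem not_finiteMutationType {e : HeavyCertificate} (he : e ∈ table)
    (hM : Δ.IsModel bd d e.links e.word t c) (hL : Δ.IsLabelling bd val r) (hk : k = e.level + d)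
    (hd : d = 0 ∨ e.kind.central = true) : ¬ (Δ.mutableQuiver val r).FiniteMutationType := by
  have h := check_table e he
  simp only [check, Bool.and_eq_true] at h
  obtain ⟨f, hf, hrows, -⟩ := hM.exists_embedding hL hk hd h.1
  exact fun hfin => hrows.not_finiteMutationType (fun i j => Δ.mutableQuiver_skew val r _ _) h.2
    (hfin.submatrix hf)

end HeavyCertificate

/-! ### Going around a puncture -/

namespace HeavyCertificate

/-- The table contains the given row of triangles. -/
def listed (k : ℕ) (q : FanKind) (w : List Bool) : Bool :=
  table.any fun e => e.level = k && e.kind = q && e.word = w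

/-- The table contains the given row of triangles or an initial segment of it. -/
def covered (k : ℕ) (q : FanKind) (w : List Bool) : Bool :=
  listed k q w || (List.range w.length).any fun n => listed k .path (w.take (n + 1))

end HeavyCertificate

namespace Triangulation

open HeavyCertificate

variable {T : Type*} {Δ : Triangulation T}

theorem turn_apply (Δ : Triangulation T) (s : T × Fin 3) :
    Δ.turn s = ((Δ.glue s).1, (Δ.glue s).2 + 1) := rfl

/-- `s` runs through the sides which start at a puncture, in their cyclic order. -/
structure IsWalk (Δ : Triangulation T) (s : ℕ → T × Fin 3) : Prop where
  succ : ∀ i, s (i + 1) = Δ.turn (s i)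
  left : ∀ i, ¬ Δ.IsBoundary (s i)
  right : ∀ i, ¬ Δ.IsBoundary ((s i).1, (s i).2 + 2)

namespace IsWalk

variable {s : ℕ → T × Fin 3}

theorem shift (hs : Δ.IsWalk s) (a : ℕ) : Δ.IsWalk fun i => s (a + i) :=
  ⟨fun i => hs.succ (a + i), fun i => hs.left (a + i), fun i => hs.right (a + i)⟩

theorem glue_eq (hs : Δ.IsWalk s) (i : ℕ) :
    Δ.glue (s i) = ((s (i + 1)).1, (s (i + 1)).2 + 2) := by
  rw [hs.succ, turn_apply, add_assoc]
  exact Prod.ext rfl (add_zero _).symm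

theorem fst_ne (hs : Δ.IsWalk s) (hΔ : Δ.Regular) (i : ℕ) : (s (i + 1)).1 ≠ (s i).1 := by
  have := hΔ (s i) (hs.left i)
  rwa [hs.glue_eq] at this

theorem eq_pow (hs : Δ.IsWalk s) (i : ℕ) : s i = (Δ.turn ^ i) (s 0) := by
  induction i with
  | zero => rfl
  | succ i ih => rw [hs.succ, ih, pow_succ']; rfl

theorem exists_period [Finite T] (hs : Δ.IsWalk s) : ∃ m, 0 < m ∧ ∀ i, s (m + i) = s i := by
  refine ⟨orderOf Δ.turn, orderOf_pos _, fun i => ?_⟩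
  rw [hs.eq_pow, hs.eq_pow i, pow_add, pow_orderOf_eq_one, one_mul]

/-- The first triangles are distinct, unless the walk closes up or returns to another corner of
one of its triangles. -/
theorem distinct_or (hs : Δ.IsWalk s) (hΔ : Δ.Regular) (N : ℕ) :
    (∀ i < N, ∀ j < N, (s i).1 = (s j).1 → i = j) ∨
      ∃ m, 2 ≤ m ∧ m < N ∧ (∀ i < m, ∀ j < m, (s i).1 = (s j).1 → i = j) ∧
        (s m = s 0 ∨ ∃ i, i + 2 ≤ m ∧ s m = ((s i).1, (s i).2 + 2)) := by
  induction N with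
  | zero => left; simp
  | succ N ih =>
    rcases ih with ih | ⟨m, h1, h2, h3⟩
    swap
    · exact .inr ⟨m, h1, by omega, h3⟩
    by_cases hN : ∃ i < N, (s N).1 = (s i).1
    · obtain ⟨i, hi, hiN⟩ := hN
      right
      have hi2 : i + 2 ≤ N := by
        by_contra h
        obtain rfl : N = i + 1 := by omega
        exact hs.fst_ne hΔ i hiN
      refine ⟨N, by omega, by omega, ih, ?_⟩
      obtain ⟨n, rfl⟩ : ∃ n, N = n + 1 := ⟨N - 1, by omega⟩
      obtain ⟨a, ha⟩ : ∃ a, (s (n + 1)).2 = (s i).2 + a :=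
        ⟨(s (n + 1)).2 - (s i).2, by rw [add_sub_cancel]⟩
      have ha3 : a = 0 ∨ a = 1 ∨ a = 2 := by clear ha; revert a; decide
      rcases ha3 with rfl | rfl | rfl
      · left
        rw [add_zero] at ha
        have hs' : s (n + 1) = s i := Prod.ext hiN ha
        rcases i with _ | i
        · exact hs'
        · rw [hs.succ, hs.succ] at hs'
          have := ih n (by omega) i (by omega) (congrArg Prod.fst (Δ.turn.injective hs'))
          omega
      · exfalso
        have h1 := hs.glue_eq n
        rw [hiN, ha, add_assoc] at h1
        have h2 : Δ.glue (s n) = s i := h1.trans (Prod.ext rfl (add_zero _))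
        have h3 : s n = ((s (i + 1)).1, (s (i + 1)).2 + 2) := by
          rw [← hs.glue_eq, ← h2, glue_glue_apply]
        have h4 := ih n (by omega) (i + 1) (by omega) (by rw [h3])
        rw [h4] at h3
        have h5 := congrArg Prod.snd h3
        simp at h5
      · exact .inr ⟨i, hi2, Prod.ext hiN ha⟩
    · left
      push Not at hN
      intro i hi j hj hij
      rcases Nat.lt_succ_iff_lt_or_eq.1 hi with hi | rfl <;>
        rcases Nat.lt_succ_iff_lt_or_eq.1 hj with hj | rfl
      · exact ih i hi j hj hij
      · exact absurd hij.symm (hN i hi)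
      · exact absurd hij (hN j hj)
      · rfl

variable {bd : T × Fin 3 → Prop}

open Classical in
/-- Whether the triangle `i` carries the quiver `Q_k^1`. -/
noncomputable def letter (bd : T × Fin 3 → Prop) (s : ℕ → T × Fin 3) (i : ℕ) : Bool :=
  decide (bd ((s i).1, (s i).2 + 1))

theorem letter_eq_true {i : ℕ} : letter bd s i = true ↔ bd ((s i).1, (s i).2 + 1) := by
  simp [letter]

theorem letter_eq_false {i : ℕ} : letter bd s i = false ↔ ¬ bd ((s i).1, (s i).2 + 1) := by
  simp [letter]

theorem bd_iff (hs : Δ.IsWalk s) (hbd : ∀ s, bd s → Δ.IsBoundary s) (i : ℕ) (j : Fin 3) :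
    bd ((s i).1, (s i).2 + j) ↔ j = 1 ∧ letter bd s i = true := by
  rw [letter_eq_true]
  have hj : j = 0 ∨ j = 1 ∨ j = 2 := by revert j; decide
  rcases hj with rfl | rfl | rfl
  · simpa using fun h => hs.left i (hbd _ h)
  · simp
  · simpa using fun h => hs.right i (hbd _ h)

/-- The way in which a row of triangles around a puncture is closed up. -/
def Closes (s : ℕ → T × Fin 3) (N : ℕ) : FanKind → Prop
  | .path => True
  | .fan => s N = s 0
  | .twist => s N = ((s 0).1, (s 0).2 + 2)
  | _ => False

theorem isModel (hs : Δ.IsWalk s) (hbd : ∀ s, bd s → Δ.IsBoundary s) {N d : ℕ} (hN : 0 < N)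
    (hinj : ∀ i < N, ∀ j < N, (s i).1 = (s j).1 → i = j) {q : FanKind} (hq : Closes s N q)
    (hd : d = 0 ∨ q.central = true) :
    Δ.IsModel bd d (q.links N) ((List.range N).map (letter bd s)) (fun i => (s i).1)
      (fun i => (s i).2) := by
  have hrow : ∀ l ∈ FanKind.row N, l.1.1 < N ∧ l.2.1 < N ∧
      ¬ Δ.IsBoundary (modelSide (fun i => (s i).1) (fun i => (s i).2) l.1) ∧
      Δ.glue (modelSide (fun i => (s i).1) (fun i => (s i).2) l.1) =
        modelSide (fun i => (s i).1) (fun i => (s i).2) l.2 := by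
    intro l hl
    obtain ⟨i, hi, rfl⟩ := List.mem_map.1 hl
    rw [List.mem_range] at hi
    simp only [modelSide, add_zero]
    exact ⟨by omega, by omega, hs.left i, hs.glue_eq i⟩
  have hglue := hs.glue_eq (N - 1)
  rw [Nat.sub_add_cancel hN] at hglue
  have hleft := hs.left (N - 1)
  refine ⟨by simpa using hinj, ?_, ?_, ?_⟩
  · simp only [List.length_map, List.length_range]
    intro l hl
    cases q with
    | path => exact hrow l hl
    | fan =>
      rcases List.mem_cons.1 hl with rfl | hl
      · rw [Closes] at hq
        rw [hq] at hglue
        simp only [modelSide, add_zero]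
        exact ⟨by omega, hN, hleft, hglue⟩
      · exact hrow l hl
    | twist =>
      rcases List.mem_cons.1 hl with rfl | hl
      · rw [Closes] at hq
        rw [hq, add_assoc] at hglue
        simp only [modelSide, add_zero]
        exact ⟨by omega, hN, hleft, hglue⟩
      · exact hrow l hl
    | ear j => exact hq.elim
    | sphere => exact hq.elim
  · intro i hi j
    rw [hs.bd_iff hbd]
    simp only [List.length_map, List.length_range] at hi
    simp [List.getD, hi]
  · refine hd.imp_right fun hc l hl => ?_
    cases q with
    | path =>
      obtain ⟨i, hi, rfl⟩ := List.mem_map.1 hl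
      exact ⟨rfl, rfl⟩
    | fan =>
      rcases List.mem_cons.1 hl with rfl | hl
      · exact ⟨rfl, rfl⟩
      · obtain ⟨i, hi, rfl⟩ := List.mem_map.1 hl
        exact ⟨rfl, rfl⟩
    | twist => cases hc
    | ear j => cases hc
    | sphere => cases hc

variable {k : ℕ} {L : Type*} {val : L → T × Hive k} {r : L → L → Prop}

theorem not_finite_of_listed (hL : Δ.IsLabelling bd val r) {k₀ d : ℕ} {q : FanKind}
    {w : List Bool} (h : listed k₀ q w = true) {t : ℕ → T} {c : ℕ → Fin 3}
    (hM : Δ.IsModel bd d (q.links w.length) w t c) (hk : k = k₀ + d)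
    (hd : d = 0 ∨ q.central = true) : ¬ (Δ.mutableQuiver val r).FiniteMutationType := by
  simp only [listed, List.any_eq_true, Bool.and_eq_true, decide_eq_true_eq] at h
  obtain ⟨e, he, ⟨rfl, rfl⟩, rfl⟩ := h
  exact not_finiteMutationType he hM hL hk hd

theorem not_finite_of_covered (hs : Δ.IsWalk s) (hL : Δ.IsLabelling bd val r) (k₀ d : ℕ) {N : ℕ}
    (hN : 0 < N) (hinj : ∀ i < N, ∀ j < N, (s i).1 = (s j).1 → i = j) {q : FanKind}
    (hq : Closes s N q) (hk : k = k₀ + d) (hd : d = 0 ∨ q.central = true)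
    (h : covered k₀ q ((List.range N).map (letter bd s)) = true) :
    ¬ (Δ.mutableQuiver val r).FiniteMutationType := by
  rw [covered, Bool.or_eq_true] at h
  rcases h with h | h
  · have := hs.isModel hL.isBoundary hN hinj hq hd
    exact not_finite_of_listed hL h (by simpa using this) hk hd
  · simp only [List.any_eq_true, List.length_map, List.length_range, List.mem_range] at h
    obtain ⟨n, hn, h⟩ := h
    rw [← List.map_take, List.take_range, min_eq_left (by omega)] at h
    have := hs.isModel (N := n + 1) (q := .path) (d := d) hL.isBoundary n.succ_pos
      (fun i hi j hj => hinj i (by omega) j (by omega)) trivial (.inr rfl)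
    exact not_finite_of_listed hL h (by simpa using this) hk (.inr rfl)

end IsWalk

end Triangulation

namespace HeavyCertificate

theorem covered_path_three : (∀ a b c d, covered 3 .path [false, true, a, b, c, d] = true) ∧
    covered 3 .path [false, false, false, false, false] = true ∧
    covered 3 .path [true, true, true, true, true, true, true] = true := by decide +kernel

theorem covered_fan_three : (∀ a, covered 3 .fan [false, true, a] = true) ∧
    (∀ a b, covered 3 .fan [false, true, a, b] = true) ∧
    (∀ a b c, covered 3 .fan [false, true, a, b, c] = true) ∧
    covered 3 .fan [false, false, false] = true ∧
    covered 3 .fan [false, false, false, false] = true ∧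
    covered 3 .fan [true, true, true, true] = true ∧
    covered 3 .fan [true, true, true, true, true] = true ∧
    covered 3 .fan [true, true, true, true, true, true] = true := by decide +kernel

theorem covered_twist_three : (∀ a, covered 3 .twist [false, a] = true) ∧
    (∀ a b, covered 3 .twist [false, a, b] = true) ∧
    (∀ a b, covered 3 .twist [false, true, a, b] = true) ∧
    (∀ a b c, covered 3 .twist [false, true, a, b, c] = true) ∧
    covered 3 .twist [false, false, false, false] = true := by decide +kernel

theorem covered_four : (∀ a b, covered 4 .path [false, true, a, b] = true) ∧
    covered 4 .path [false, false, false] = true ∧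
    covered 4 .path [true, true, true, true, true] = true ∧
    (∀ a, covered 4 .fan [false, a] = true) ∧ (∀ a, covered 4 .fan [false, true, a] = true) ∧
    covered 4 .fan [true, true, true] = true ∧ covered 4 .fan [true, true, true, true] = true ∧
    (∀ a, covered 4 .twist [false, a] = true) ∧
    (∀ a, covered 4 .twist [false, true, a] = true) := by decide +kernel

theorem covered_five : covered 5 .path [false, false] = true ∧
    (∀ a, covered 5 .path [false, true, a] = true) ∧
    covered 5 .path [true, true, true, true] = true ∧ covered 5 .fan [false, true] = true ∧
    covered 5 .fan [true, true] = true ∧ covered 5 .fan [true, true, true] = true ∧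
    covered 5 .twist [false, true] = true ∧ covered 6 .path [false, true] = true := by
  decide +kernel

theorem listed_ear : (∀ a b, listed 3 (.ear 0) [false, a, b] = true) ∧
    (∀ a, listed 3 (.ear 2) [false, a, true] = true) ∧
    listed 3 .sphere [false, false] = true := by decide +kernel

end HeavyCertificate

namespace Triangulation

open HeavyCertificate

variable {T : Type*} {Δ : Triangulation T} {bd : T × Fin 3 → Prop}

/-- A puncture in a disk, joined to the marked points of the boundary circle. -/
structure IsWheel (Δ : Triangulation T) (s : ℕ → T × Fin 3) (m : ℕ) : Prop extends Δ.IsWalk s where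
  two_le : 2 ≤ m
  inj : ∀ i < m, ∀ j < m, (s i).1 = (s j).1 → i = j
  closes : s m = s 0
  isBoundary : ∀ i < m, Δ.IsBoundary ((s i).1, (s i).2 + 1)

namespace IsWalk

variable {s : ℕ → T × Fin 3} {k : ℕ} {L : Type*} {val : L → T × Hive k} {r : L → L → Prop}

theorem twist_side (hs : Δ.IsWalk s) {i m : ℕ} (hi : i + 2 ≤ m)
    (h : s m = ((s i).1, (s i).2 + 2)) : ¬ Δ.IsBoundary ((s i).1, (s i).2 + 1) := by
  obtain ⟨m, rfl⟩ : ∃ n, m = n + 1 := ⟨m - 1, by omega⟩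
  have := not_isBoundary_glue (hs.left m)
  rw [hs.glue_eq, h, add_assoc] at this
  exact this

theorem not_finite_of_twist (hs : Δ.IsWalk s) (hL : Δ.IsLabelling bd val r) {i m : ℕ}
    (hinj : ∀ i < m, ∀ j < m, (s i).1 = (s j).1 → i = j) (hi : i + 2 ≤ m)
    (h : s m = ((s i).1, (s i).2 + 2))
    (hc : letter bd s i = false →
      covered k .twist ((List.range (m - i)).map fun n => letter bd s (i + n)) = true) :
    ¬ (Δ.mutableQuiver val r).FiniteMutationType := by
  refine (hs.shift i).not_finite_of_covered hL k 0 (N := m - i) (by omega)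
    (fun a ha b hb hab => by have := hinj (i + a) (by omega) (i + b) (by omega) hab; omega)
    (q := .twist) ?_ rfl (.inl rfl)
    (hc (letter_eq_false.2 fun hb => hs.twist_side hi h (hL.isBoundary _ hb)))
  change s (i + (m - i)) = ((s (i + 0)).1, (s (i + 0)).2 + 2)
  rw [Nat.add_sub_cancel' (by omega), h, add_zero]

/-- Two triangles with two common sides, and a third triangle. -/
theorem not_finite_of_ear (hs : Δ.IsWalk s) (hL : Δ.IsLabelling bd val r) (hΔ : Δ.Regular)
    (hone : ∀ t i j, bd (t, i) → bd (t, j) → i = j) (hk : k = 3) (h2 : s 2 = s 0)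
    (h : ¬ Δ.IsBoundary ((s 0).1, (s 0).2 + 1)) :
    ¬ (Δ.mutableQuiver val r).FiniteMutationType := by
  have h01 : (s 1).1 ≠ (s 0).1 := hs.fst_ne hΔ 0
  have g0 : Δ.glue (s 0) = ((s 1).1, (s 1).2 + 2) := hs.glue_eq 0
  have g1 : Δ.glue (s 1) = ((s 0).1, (s 0).2 + 2) := by rw [hs.glue_eq 1, h2]
  have hl0 : letter bd s 0 = false := letter_eq_false.2 fun hb => h (hL.isBoundary _ hb)
  have hne := hΔ _ h
  obtain ⟨⟨t', j'⟩, hg⟩ : ∃ u, Δ.glue ((s 0).1, (s 0).2 + 1) = u := ⟨_, rfl⟩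
  have hb' := not_isBoundary_glue h
  have hg' : Δ.glue (t', j') = ((s 0).1, (s 0).2 + 1) := by rw [← hg, glue_glue_apply]
  rw [hg] at hne hb'
  simp only at hne
  by_cases ht : t' = (s 1).1
  · subst ht
    have hj : j' = (s 1).2 + 1 := by
      obtain ⟨a, rfl⟩ : ∃ a, j' = (s 1).2 + a := ⟨j' - (s 1).2, by rw [add_sub_cancel]⟩
      have ha : a = 0 ∨ a = 1 ∨ a = 2 := by clear hg hb' hg'; revert a; decide
      rcases ha with rfl | rfl | rfl
      · rw [add_zero, Prod.mk.eta, g1] at hg'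
        have := congrArg Prod.snd hg'
        simp at this
      · rfl
      · rw [← g0, glue_glue_apply] at hg'
        have := congrArg Prod.snd hg'
        simp at this
    subst hj
    have hl1 : letter bd s 1 = false := letter_eq_false.2 fun hb => hb' (hL.isBoundary _ hb)
    refine not_finite_of_listed hL (d := 0) listed_ear.2.2 (t := fun i => (s i).1)
      (c := fun i => (s i).2) ⟨?_, ?_, ?_, .inl rfl⟩ hk (.inl rfl)
    · intro i hi j hj hij
      simp only [List.length_cons, List.length_nil] at hi hj
      interval_cases i <;> interval_cases j <;> first | rfl | exact absurd hij h01 |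
        exact absurd hij.symm h01
    · intro l hl
      simp only [FanKind.links, List.mem_cons, List.not_mem_nil, or_false] at hl
      rcases hl with rfl | rfl | rfl <;> simp only [modelSide, add_zero, List.length_cons]
      · exact ⟨by simp, by simp, hs.left 0, g0⟩
      · exact ⟨by simp, by simp, hs.left 1, g1⟩
      · exact ⟨by simp, by simp, h, hg⟩
    · intro i hi j
      rw [hs.bd_iff hL.isBoundary]
      simp only [List.length_cons, List.length_nil] at hi
      interval_cases i <;> simp [hl0, hl1]
  · have main : ∀ (e : Fin 3) (x : Bool) (c' : Fin 3), j' = c' + e →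
        listed 3 (.ear e) [false, letter bd s 1, x] = true →
        (∀ j, bd (t', c' + j) ↔ j = 1 ∧ x = true) →
        ¬ (Δ.mutableQuiver val r).FiniteMutationType := by
      intro e x c' hj' hlist hlet
      refine not_finite_of_listed hL (d := 0) hlist
        (t := fun i => if i = 2 then t' else (s i).1)
        (c := fun i => if i = 2 then c' else (s i).2) ⟨?_, ?_, ?_, .inl rfl⟩ hk (.inl rfl)
      · intro i hi j hj hij
        simp only [List.length_cons, List.length_nil] at hi hj
        interval_cases i <;> interval_cases j <;> simp at hij ⊢
        · exact h01 hij.symm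
        · exact hne hij.symm
        · exact h01 hij
        · exact ht hij.symm
        · exact hne hij
        · exact ht hij
      · intro l hl
        simp only [FanKind.links, List.mem_cons, List.not_mem_nil, or_false] at hl
        rcases hl with rfl | rfl | rfl <;> simp only [modelSide, add_zero, List.length_cons]
        · exact ⟨by simp, by simp, hs.left 0, g0⟩
        · exact ⟨by simp, by simp, hs.left 1, g1⟩
        · exact ⟨by simp, by simp, h, by subst hj'; exact hg⟩
      · intro i hi j
        simp only [List.length_cons, List.length_nil] at hi
        interval_cases i
        · simpa [hl0] using hs.bd_iff hL.isBoundary 0 j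
        · simpa using hs.bd_iff hL.isBoundary 1 j
        · simpa using hlet j
    by_cases hx : ∃ j, bd (t', j)
    · obtain ⟨j, hj⟩ := hx
      have hlet : ∀ a, bd (t', j + 2 + a) ↔ a = 1 ∧ true = true := by
        intro a
        have e : j + 2 + 1 = j := by rw [add_assoc]; exact add_zero _
        constructor
        · intro ha
          exact ⟨add_left_cancel ((hone _ _ _ ha hj).trans e.symm), rfl⟩
        · rintro ⟨rfl, -⟩
          rwa [e]
      obtain ⟨a, rfl⟩ : ∃ a, j' = j + 2 + a := ⟨j' - (j + 2), by rw [add_sub_cancel]⟩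
      have ha : a = 0 ∨ a = 1 ∨ a = 2 := by clear hg hb' hg' main; revert a; decide
      rcases ha with rfl | rfl | rfl
      · exact main 0 true (j + 2) rfl (listed_ear.1 _ _) hlet
      · exact absurd (hL.isBoundary _ ((hlet 1).2 ⟨rfl, rfl⟩)) hb'
      · exact main 2 true (j + 2) rfl (listed_ear.2.1 _) hlet
    · push Not at hx
      exact main 0 false j' (add_zero _).symm (listed_ear.1 _ _) fun a => by
        simp [hx]

/-- Both kinds of triangles occur around the puncture. -/
theorem isWheel_of_mixed (hs : Δ.IsWalk s) (hL : Δ.IsLabelling bd val r) (hΔ : Δ.Regular)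
    (hone : ∀ t i j, bd (t, i) → bd (t, j) → i = j) (hk : 3 ≤ k) (h0 : letter bd s 0 = false)
    (h1 : letter bd s 1 = true) (hfin : (Δ.mutableQuiver val r).FiniteMutationType) :
    IsWheel Δ s 2 ∧ k = 3 := by
  rcases lt_or_ge 5 k with hk6 | hk6
  · exfalso
    rcases hs.distinct_or hΔ 2 with h | ⟨m, h2, hm, -⟩
    · refine hs.not_finite_of_covered hL 6 (k - 6) two_pos h (q := .path) trivial (by omega)
        (.inr rfl) ?_ hfin
      change covered 6 .path [letter bd s 0, letter bd s 1] = true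
      rw [h0, h1]
      exact covered_five.2.2.2.2.2.2.2
    · omega
  obtain rfl | rfl | rfl : k = 3 ∨ k = 4 ∨ k = 5 := by omega
  · rcases hs.distinct_or hΔ 6 with h | ⟨m, h2, hm, hinj, hc | ⟨i, hi, hc⟩⟩
    · refine absurd hfin (hs.not_finite_of_covered hL 3 0 (by omega) h (q := .path) trivial rfl
        (.inl rfl) ?_)
      change covered 3 .path [letter bd s 0, letter bd s 1, _, _, _, _] = true
      rw [h0, h1]
      exact covered_path_three.1 _ _ _ _
    · by_cases hm2 : m = 2
      · subst hm2
        refine ⟨⟨hs, le_rfl, hinj, hc, fun i hi => ?_⟩, rfl⟩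
        by_contra hb
        interval_cases i
        · exact hs.not_finite_of_ear hL hΔ hone rfl hc hb hfin
        · exact hb (hL.isBoundary _ (letter_eq_true.1 h1))
      · refine absurd hfin (hs.not_finite_of_covered hL 3 0 (by omega) hinj (q := .fan) hc rfl
          (.inl rfl) ?_)
        obtain rfl | rfl | rfl : m = 3 ∨ m = 4 ∨ m = 5 := by omega
        · change covered 3 .fan [letter bd s 0, letter bd s 1, _] = true
          rw [h0, h1]
          exact covered_fan_three.1 _
        · change covered 3 .fan [letter bd s 0, letter bd s 1, _, _] = true
          rw [h0, h1]
          exact covered_fan_three.2.1 _ _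
        · change covered 3 .fan [letter bd s 0, letter bd s 1, _, _, _] = true
          rw [h0, h1]
          exact covered_fan_three.2.2.1 _ _ _
    · refine absurd hfin (hs.not_finite_of_twist hL hinj hi hc fun hl => ?_)
      obtain ⟨n, rfl⟩ : ∃ n, m = i + n := ⟨m - i, by omega⟩
      rw [Nat.add_sub_cancel_left]
      obtain rfl | rfl | rfl | rfl : n = 2 ∨ n = 3 ∨ n = 4 ∨ n = 5 := by omega
      · change covered 3 .twist [letter bd s i, _] = true
        rw [hl]
        exact covered_twist_three.1 _
      · change covered 3 .twist [letter bd s i, _, _] = true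
        rw [hl]
        exact covered_twist_three.2.1 _ _
      · obtain rfl | rfl : i = 0 ∨ i = 1 := by omega
        · change covered 3 .twist [letter bd s 0, letter bd s 1, _, _] = true
          rw [h0, h1]
          exact covered_twist_three.2.2.1 _ _
        · rw [h1] at hl
          cases hl
      · obtain rfl : i = 0 := by omega
        change covered 3 .twist [letter bd s 0, letter bd s 1, _, _, _] = true
        rw [h0, h1]
        exact covered_twist_three.2.2.2.1 _ _ _
  · exfalso
    rcases hs.distinct_or hΔ 4 with h | ⟨m, h2, hm, hinj, hc | ⟨i, hi, hc⟩⟩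
    · refine hs.not_finite_of_covered hL 4 0 (by omega) h (q := .path) trivial rfl
        (.inl rfl) ?_ hfin
      change covered 4 .path [letter bd s 0, letter bd s 1, _, _] = true
      rw [h0, h1]
      exact covered_four.1 _ _
    · refine hs.not_finite_of_covered hL 4 0 (by omega) hinj (q := .fan) hc rfl
        (.inl rfl) ?_ hfin
      obtain rfl | rfl : m = 2 ∨ m = 3 := by omega
      · change covered 4 .fan [letter bd s 0, letter bd s 1] = true
        rw [h0]
        exact covered_four.2.2.2.1 _
      · change covered 4 .fan [letter bd s 0, letter bd s 1, _] = true
        rw [h0, h1]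
        exact covered_four.2.2.2.2.1 _
    · refine hs.not_finite_of_twist hL hinj hi hc (fun hl => ?_) hfin
      obtain ⟨n, rfl⟩ : ∃ n, m = i + n := ⟨m - i, by omega⟩
      rw [Nat.add_sub_cancel_left]
      obtain rfl | rfl : n = 2 ∨ n = 3 := by omega
      · change covered 4 .twist [letter bd s i, _] = true
        rw [hl]
        exact covered_four.2.2.2.2.2.2.2.1 _
      · obtain rfl : i = 0 := by omega
        change covered 4 .twist [letter bd s 0, letter bd s 1, _] = true
        rw [h0, h1]
        exact covered_four.2.2.2.2.2.2.2.2 _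
  · exfalso
    rcases hs.distinct_or hΔ 3 with h | ⟨m, h2, hm, hinj, hc⟩
    · refine hs.not_finite_of_covered hL 5 0 (by omega) h (q := .path) trivial rfl
        (.inl rfl) ?_ hfin
      change covered 5 .path [letter bd s 0, letter bd s 1, _] = true
      rw [h0, h1]
      exact covered_five.2.1 _
    · obtain rfl : m = 2 := by omega
      rcases hc with hc | ⟨i, hi, hc⟩
      · refine hs.not_finite_of_covered hL 5 0 (by omega) hinj (q := .fan) hc rfl
          (.inl rfl) ?_ hfin
        change covered 5 .fan [letter bd s 0, letter bd s 1] = true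
        rw [h0, h1]
        exact covered_five.2.2.2.1
      · obtain rfl : i = 0 := by omega
        refine hs.not_finite_of_twist hL hinj hi hc (fun hl => ?_) hfin
        change covered 5 .twist [letter bd s 0, letter bd s 1] = true
        rw [h0, h1]
        exact covered_five.2.2.2.2.2.2.1

/-- All triangles around the puncture carry the quiver `Q_k`. -/
theorem isWheel_of_all_false (hs : Δ.IsWalk s) (hL : Δ.IsLabelling bd val r) (hΔ : Δ.Regular)
    (hone : ∀ t i j, bd (t, i) → bd (t, j) → i = j) (hk : 3 ≤ k)
    (hl : ∀ i, letter bd s i = false) (hfin : (Δ.mutableQuiver val r).FiniteMutationType) :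
    IsWheel Δ s 2 ∧ k = 3 := by
  have hmap : ∀ n a, ((List.range n).map fun i => letter bd s (a + i)) =
      List.replicate n false := fun n a => by simp [hl, List.map_const']
  have hmap0 : ∀ n, ((List.range n).map (letter bd s)) = List.replicate n false := fun n => by
    simpa using hmap n 0
  rcases lt_or_ge 4 k with hk5 | hk5
  · exfalso
    rcases hs.distinct_or hΔ 2 with h | ⟨m, h2, hm, -⟩
    · refine hs.not_finite_of_covered hL 5 (k - 5) two_pos h (q := .path) trivial (by omega)
        (.inr rfl) ?_ hfin
      rw [hmap0]
      exact covered_five.1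
    · omega
  obtain rfl | rfl : k = 3 ∨ k = 4 := by omega
  · rcases hs.distinct_or hΔ 5 with h | ⟨m, h2, hm, hinj, hc | ⟨i, hi, hc⟩⟩
    · refine absurd hfin (hs.not_finite_of_covered hL 3 0 (by omega) h (q := .path) trivial rfl
        (.inl rfl) ?_)
      rw [hmap0]
      exact covered_path_three.2.1
    · by_cases hm2 : m = 2
      · subst hm2
        refine ⟨⟨hs, le_rfl, hinj, hc, fun i hi => ?_⟩, rfl⟩
        by_contra hb
        interval_cases i
        · exact hs.not_finite_of_ear hL hΔ hone rfl hc hb hfin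
        · refine (hs.shift 1).not_finite_of_ear hL hΔ hone rfl ?_ hb hfin
          change s (2 + 1) = s (0 + 1)
          rw [hs.succ 2, hs.succ 0, hc]
      · refine absurd hfin (hs.not_finite_of_covered hL 3 0 (by omega) hinj (q := .fan) hc rfl
          (.inl rfl) ?_)
        rw [hmap0]
        obtain rfl | rfl : m = 3 ∨ m = 4 := by omega
        · exact covered_fan_three.2.2.2.1
        · exact covered_fan_three.2.2.2.2.1
    · refine absurd hfin (hs.not_finite_of_twist hL hinj hi hc fun _ => ?_)
      rw [hmap]
      obtain h | h | h : m - i = 2 ∨ m - i = 3 ∨ m - i = 4 := by omega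
      · rw [h]
        exact covered_twist_three.1 _
      · rw [h]
        exact covered_twist_three.2.1 _ _
      · rw [h]
        exact covered_twist_three.2.2.2.2
  · exfalso
    rcases hs.distinct_or hΔ 3 with h | ⟨m, h2, hm, hinj, hc⟩
    · refine hs.not_finite_of_covered hL 4 0 (by omega) h (q := .path) trivial rfl
        (.inl rfl) ?_ hfin
      rw [hmap0]
      exact covered_four.2.1
    · obtain rfl : m = 2 := by omega
      rcases hc with hc | ⟨i, hi, hc⟩
      · refine hs.not_finite_of_covered hL 4 0 (by omega) hinj (q := .fan) hc rfl
          (.inl rfl) ?_ hfin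
        rw [hmap0]
        exact covered_four.2.2.2.1 _
      · obtain rfl : i = 0 := by omega
        refine hs.not_finite_of_twist hL hinj hi hc (fun _ => ?_) hfin
        rw [hmap]
        exact covered_four.2.2.2.2.2.2.2.1 _

/-- All triangles around the puncture carry the quiver `Q_k^1`. -/
theorem isWheel_of_all_true (hs : Δ.IsWalk s) (hL : Δ.IsLabelling bd val r) (hΔ : Δ.Regular)
    (hk : 3 ≤ k) (hl : ∀ i, letter bd s i = true)
    (hfin : (Δ.mutableQuiver val r).FiniteMutationType) :
    ∃ m, IsWheel Δ s m ∧ ((m = 2 ∧ (k = 3 ∨ k = 4)) ∨ (m = 3 ∧ k = 3)) := by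
  have hmap : ∀ n, ((List.range n).map (letter bd s)) = List.replicate n true := fun n => by
    rw [show letter bd s = fun _ => true from funext hl, List.map_const', List.length_range]
  have hdist : ∀ N, (∀ i < N, ∀ j < N, (s i).1 = (s j).1 → i = j) ∨
      ∃ m, m < N ∧ IsWheel Δ s m := by
    intro N
    rcases hs.distinct_or hΔ N with h | ⟨m, h2, hm, hinj, hc | ⟨i, hi, hc⟩⟩
    · exact .inl h
    · exact .inr ⟨m, hm, hs, h2, hinj, hc,
        fun i _ => hL.isBoundary _ (letter_eq_true.1 (hl i))⟩
    · exact absurd (hL.isBoundary _ (letter_eq_true.1 (hl i))) (hs.twist_side hi hc)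
  have hpath : ∀ k₀ N, 0 < N → k₀ ≤ k → covered k₀ .path (List.replicate N true) = true →
      ¬ (∀ i < N, ∀ j < N, (s i).1 = (s j).1 → i = j) := by
    intro k₀ N hN hk₀ h hinj
    exact hs.not_finite_of_covered hL k₀ (k - k₀) hN hinj (q := .path) trivial (by omega)
      (.inr rfl) (by rwa [hmap]) hfin
  have hfan : ∀ k₀ m, IsWheel Δ s m → k₀ ≤ k →
      covered k₀ .fan (List.replicate m true) ≠ true := by
    intro k₀ m hw hk₀ h
    exact hs.not_finite_of_covered hL k₀ (k - k₀) (by have := hw.two_le; omega) hw.inj (q := .fan)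
      hw.closes (by omega) (.inr rfl) (by rwa [hmap]) hfin
  rcases lt_or_ge 4 k with hk5 | hk5
  · exfalso
    rcases hdist 4 with h | ⟨m, hm, hw⟩
    · exact hpath 5 4 (by omega) hk5 covered_five.2.2.1 h
    · have := hw.two_le
      obtain rfl | rfl : m = 2 ∨ m = 3 := by omega
      · exact hfan 5 2 hw hk5 covered_five.2.2.2.2.1
      · exact hfan 5 3 hw hk5 covered_five.2.2.2.2.2.1
  obtain rfl | rfl : k = 3 ∨ k = 4 := by omega
  · rcases hdist 7 with h | ⟨m, hm, hw⟩
    · exact absurd h (hpath 3 7 (by omega) le_rfl covered_path_three.2.2)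
    · have := hw.two_le
      refine ⟨m, hw, ?_⟩
      obtain rfl | rfl | rfl | rfl | rfl : m = 2 ∨ m = 3 ∨ m = 4 ∨ m = 5 ∨ m = 6 := by omega
      · omega
      · omega
      · exact absurd covered_fan_three.2.2.2.2.2.1 (hfan 3 4 hw le_rfl)
      · exact absurd covered_fan_three.2.2.2.2.2.2.1 (hfan 3 5 hw le_rfl)
      · exact absurd covered_fan_three.2.2.2.2.2.2.2 (hfan 3 6 hw le_rfl)
  · rcases hdist 5 with h | ⟨m, hm, hw⟩
    · exact absurd h (hpath 4 5 (by omega) le_rfl covered_four.2.2.1)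
    · have := hw.two_le
      refine ⟨m, hw, ?_⟩
      obtain rfl | rfl | rfl : m = 2 ∨ m = 3 ∨ m = 4 := by omega
      · omega
      · exact absurd covered_four.2.2.2.2.2.1 (hfan 4 3 hw le_rfl)
      · exact absurd covered_four.2.2.2.2.2.2.1 (hfan 4 4 hw le_rfl)

/-- If the quiver has finite mutation type, then the triangles around a puncture form a wheel. -/
theorem exists_isWheel [Finite T] (hs : Δ.IsWalk s) (hL : Δ.IsLabelling bd val r)
    (hΔ : Δ.Regular) (hone : ∀ t i j, bd (t, i) → bd (t, j) → i = j) (hk : 3 ≤ k)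
    (hfin : (Δ.mutableQuiver val r).FiniteMutationType) :
    ∃ s' m, IsWheel Δ s' m ∧ ((m = 2 ∧ k = 3) ∨
      ((∃ t, bd t) ∧ ((m = 2 ∧ k = 4) ∨ (m = 3 ∧ k = 3)))) := by
  by_cases hl : ∀ i, letter bd s i = true
  · obtain ⟨m, hw, h⟩ := hs.isWheel_of_all_true hL hΔ hk hl hfin
    refine ⟨s, m, hw, ?_⟩
    have : ∃ t, bd t := ⟨_, letter_eq_true.1 (hl 0)⟩
    tauto
  by_cases hl' : ∀ i, letter bd s i = false
  · obtain ⟨hw, rfl⟩ := hs.isWheel_of_all_false hL hΔ hone hk hl' hfin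
    exact ⟨s, 2, hw, .inl ⟨rfl, rfl⟩⟩
  push Not at hl hl'
  obtain ⟨a, ha⟩ := hl
  obtain ⟨b, hb⟩ := hl'
  replace ha : letter bd s a = false := by simpa using ha
  replace hb : letter bd s b = true := by simpa using hb
  obtain ⟨p, hp, hper⟩ := hs.exists_period
  have hmul : ∀ n i, s (n * p + i) = s i := by
    intro n i
    induction n with
    | zero => rw [zero_mul, zero_add]
    | succ n ih => rw [add_mul, one_mul, add_comm (n * p) p, add_assoc, hper, ih]
  have hex : ∃ n, letter bd s (a + n) = true := by
    have hap : a ≤ a * p := Nat.le_mul_of_pos_right a hp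
    refine ⟨a * p + b - a, ?_⟩
    rw [Nat.add_sub_cancel' (by omega), letter, hmul]
    exact hb
  classical
  obtain ⟨n, hn⟩ : ∃ n, Nat.find hex = n + 1 := by
    refine ⟨Nat.find hex - 1, ?_⟩
    have : Nat.find hex ≠ 0 := by
      intro h0
      have := Nat.find_spec hex
      rw [h0, add_zero, ha] at this
      cases this
    omega
  have h1 := Nat.find_spec hex
  rw [hn] at h1
  have h0 : letter bd s (a + n) = false := by
    have := Nat.find_min hex (m := n) (by omega)
    simpa using this
  obtain ⟨hw, rfl⟩ := (hs.shift (a + n)).isWheel_of_mixed hL hΔ hone hk h0 h1 hfin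
  exact ⟨_, 2, hw, .inl ⟨rfl, rfl⟩⟩

end IsWalk

end Triangulation

/-! ### The quivers of finite mutation type -/

namespace Matrix

theorem HasRows.ext {n : ℕ} {B B' : Matrix (Fin n) (Fin n) ℤ} {L : List (List ℤ)}
    (h : B.HasRows L) (h' : B'.HasRows L) : B = B' := by
  ext i j
  rw [← h.getD, ← h'.getD]

instance {n : ℕ} (B : Matrix (Fin n) (Fin n) ℤ) (L : List (List ℤ)) : Decidable (B.HasRows L) :=
  inferInstanceAs (Decidable (L = _))

/-- The matrices, up to relabelling, in the mutation class of the quivers which are given by the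
triangulations of the sphere with four punctures. -/
def fourPuncturedRows : Fin 4 → List (List ℤ)
  | 0 => [[0, 1, 0, 0, -1, 0], [-1, 0, 1, 1, 0, -1], [0, -1, 0, 0, 1, 0], [0, -1, 0, 0, 1, 0],
      [1, 0, -1, -1, 0, 1], [0, 1, 0, 0, -1, 0]]
  | 1 => [[0, -1, 0, 0, 1, 0], [1, 0, 1, 1, -1, -1], [0, -1, 0, 0, 1, 0], [0, -1, 0, 0, 1, 0],
      [-1, 1, -1, -1, 0, 1], [0, 1, 0, 0, -1, 0]]
  | 2 => [[0, -1, 1, 1, -1, 0], [1, 0, -1, -1, 0, 1], [-1, 1, 0, 0, 1, -1], [-1, 1, 0, 0, 1, -1],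
      [1, 0, -1, -1, 0, 1], [0, -1, 1, 1, -1, 0]]
  | 3 => [[0, -1, 0, 0, 1, 0], [1, 0, 1, 1, -2, 1], [0, -1, 0, 0, 1, 0], [0, -1, 0, 0, 1, 0],
      [-1, 2, -1, -1, 0, -1], [0, -1, 0, 0, 1, 0]]

/-- The matrix with the rows `fourPuncturedRows a`. -/
def fourPunctured (a : Fin 4) : Matrix (Fin 6) (Fin 6) ℤ :=
  of fun i j => ((fourPuncturedRows a).getD i []).getD j 0

theorem hasRows_fourPunctured (a : Fin 4) : (fourPunctured a).HasRows (fourPuncturedRows a) := by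
  fin_cases a <;> rfl

/-- The mutation of `fourPunctured a` at the vertex `v` is a relabelling of another one of these
matrices. -/
def fourPuncturedMutation : Fin 4 → Fin 6 → Fin 4 × (Fin 6 → Fin 6)
  | 0, v => (![1, 2, 1, 1, 2, 1] v, ![![0, 1, 2, 3, 4, 5], ![0, 1, 2, 3, 4, 5],
      ![0, 4, 2, 5, 1, 3], ![0, 4, 5, 2, 1, 3], ![0, 2, 1, 4, 3, 5], ![5, 1, 0, 2, 4, 3]] v)
  | 1, v => (![0, 1, 0, 0, 1, 3] v, ![![0, 1, 2, 3, 4, 5], ![0, 4, 2, 3, 5, 1],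
      ![0, 4, 2, 5, 1, 3], ![0, 4, 5, 2, 1, 3], ![0, 5, 2, 3, 1, 4], ![0, 1, 2, 3, 4, 5]] v)
  | 2, v => (![0, 0, 0, 0, 0, 0] v, ![![1, 2, 0, 5, 3, 4], ![0, 1, 2, 3, 4, 5],
      ![0, 2, 4, 1, 3, 5], ![0, 2, 1, 4, 3, 5], ![0, 4, 2, 3, 1, 5], ![1, 0, 2, 3, 5, 4]] v)
  | 3, v => (![1, 3, 1, 1, 3, 1] v, ![![5, 1, 0, 2, 4, 3], ![0, 4, 2, 3, 1, 5],
      ![0, 1, 5, 2, 4, 3], ![0, 1, 2, 5, 4, 3], ![0, 4, 2, 3, 1, 5], ![0, 1, 2, 3, 4, 5]] v)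

theorem fourPuncturedMutation_spec (a : Fin 4) (v : Fin 6) :
    (List.ofFn (fourPuncturedMutation a v).2).Nodup ∧ ∀ i j : Fin 6,
      ((mutateRows v (fourPuncturedRows a)).getD i []).getD j 0 =
        fourPunctured (fourPuncturedMutation a v).1 ((fourPuncturedMutation a v).2 i)
          ((fourPuncturedMutation a v).2 j) := by
  revert a v
  decide +kernel

theorem finiteMutationType_fourPunctured (a : Fin 4) : (fourPunctured a).FiniteMutationType := by
  refine finiteMutationType_of_closed fourPunctured (fun a v => ?_) a
  obtain ⟨h1, h2⟩ := fourPuncturedMutation_spec a v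
  refine ⟨(fourPuncturedMutation a v).1, Equiv.ofBijective _
    (Finite.injective_iff_bijective.1 (List.nodup_ofFn.1 h1)), ?_⟩
  ext i j
  rw [← ((hasRows_fourPunctured a).mutate v).getD, h2]
  rfl

end Matrix

namespace Links

open ModelPoint

/-- Every vertex outside of the sides `1` belongs to one of the classes of the vertices in `V`. -/
def complete (K : Links) (w : List Bool) (k : ℕ) (V : List ModelPoint) : Bool :=
  let Cs := K.classes w V
  (List.range w.length).all fun i => (List.range k).all fun x => (List.range k).all fun y =>
    !(x + y ≤ k) || !retained w (i, x, y, k - x - y) || x == 0 ||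
      Cs.any fun C => C.contains (i, x, y, k - x - y)

end Links

namespace Triangulation

variable {T : Type*} {Δ : Triangulation T} {bd : T × Fin 3 → Prop}

namespace IsWheel

open IsWalk

variable {s : ℕ → T × Fin 3} {k m : ℕ} {L : Type*} {val : L → T × Hive k} {r : L → L → Prop}

theorem finiteMutationType_of_complete (hs : Δ.IsWheel s m) (hL : Δ.IsLabelling bd val r)
    (hT : ∀ t, ∃ i < m, t = (s i).1) {V : List ModelPoint} {w : List Bool}
    (hw : (List.range m).map (letter bd s) = w)
    (hV : (FanKind.fan.links m).independent w k true V = true)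
    (hc : (FanKind.fan.links m).complete w k V = true)
    {B : Matrix (Fin V.length) (Fin V.length) ℤ}
    (hB : B.HasRows ((FanKind.fan.links m).rows w V)) (hfin : B.FiniteMutationType) :
    (Δ.mutableQuiver val r).FiniteMutationType := by
  have hm := hs.two_le
  have hM := hs.toIsWalk.isModel (q := .fan) (d := 0) hL.isBoundary (by omega) hs.inj hs.closes
    (.inl rfl)
  rw [hw] at hM
  have hlen : w.length = m := by rw [← hw]; simp
  obtain ⟨f, hf, hrows, hcl⟩ := hM.exists_embedding hL (k₀ := k) rfl (.inl rfl) hV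
  have hsurj : f.Surjective := by
    rintro ⟨v, hv⟩
    obtain ⟨l, rfl⟩ := v.exists_rep
    obtain ⟨i, hi, hti⟩ := hT (val l).1
    have hsum := (val l).2.sum_coord (s i).2
    have hlt := (val l).2.coord_lt
    set x := (val l).2.coord (s i).2 with hx
    set y := (val l).2.coord ((s i).2 + 1) with hy
    have hmatch : Matches 0 (fun i => (s i).1) (fun i => (s i).2) (i, x, y, k - x - y) (val l) := by
      refine ⟨hti, fun j => ?_⟩
      have hj : j = 0 ∨ j = 1 ∨ j = 2 := by revert j; decide
      rcases hj with rfl | rfl | rfl <;> (simp [ModelPoint.cd, ← hx, ← hy]; try omega)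
    have hx0 : x ≠ 0 := by
      intro h0
      refine hv l rfl ⟨(s i).2 + 1, ?_, ?_⟩
      · rw [hti]
        exact hs.isBoundary i hi
      · rw [OnSide, add_assoc]
        change (val l).2.coord ((s i).2 + 0) = 0
        rw [add_zero, ← hx, h0]
    have hret : ModelPoint.retained w (i, x, y, k - x - y) = true :=
      (hM.retainedAt_iff (by rw [hlen]; exact hi) (.inl rfl) hmatch).1
        ((hL.exists_iff _).1 ⟨l, rfl⟩)
    simp only [Links.complete, List.all_eq_true, List.mem_range, hlen] at hc
    have := hc i hi x (hlt _) y (hlt _)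
    simp only [hret, Bool.or_eq_true, Bool.not_eq_true', beq_iff_eq, hx0, decide_eq_false_iff_not,
      List.any_eq_true, List.contains_iff_mem, Bool.not_true, or_false] at this
    rcases this with (h | h) | ⟨C, hC, hP⟩
    · omega
    · cases h
    · obtain ⟨P, hPV, rfl⟩ := List.mem_map.1 hC
      obtain ⟨a, ha, rfl⟩ := List.getElem_of_mem hPV
      exact ⟨⟨a, ha⟩, Subtype.ext ((hcl ⟨a, ha⟩ l).2 ⟨_, hP, hmatch⟩).symm⟩
  have hBf : B = (Δ.mutableQuiver val r).submatrix f f := hB.ext hrows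
  let e := Equiv.ofBijective f ⟨hf, hsurj⟩
  have : Δ.mutableQuiver val r = B.submatrix e.symm e.symm := by
    rw [hBf]
    ext u v
    change _ = Δ.mutableQuiver val r (e (e.symm u)) (e (e.symm v))
    rw [Equiv.apply_symm_apply, Equiv.apply_symm_apply]
  rw [this]
  exact hfin.submatrix e.symm.injective

end IsWheel

open IsWalk

variable {s : ℕ → T × Fin 3}

theorem IsWheel.finiteMutationType_fg (hs : Δ.IsWheel s 2) (hT : ∀ t, ∃ i < 2, t = (s i).1) :
    (Δ.fgQuiver 3).FiniteMutationType :=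
  hs.finiteMutationType_of_complete (Δ.isLabelling_fg 3) hT (w := [false, false])
    (V := [(0, 1, 0, 2), (0, 1, 1, 1), (0, 2, 0, 1), (0, 1, 2, 0), (1, 1, 1, 1), (0, 2, 1, 0)])
    (by simp [letter, List.range_succ]) (by decide +kernel) (by decide +kernel)
    (B := Matrix.fourPunctured 0) (by decide +kernel) (Matrix.finiteMutationType_fourPunctured 0)

theorem IsWheel.map_letter_isBoundary {m : ℕ} (hs : Δ.IsWheel s m) :
    (List.range m).map (letter Δ.IsBoundary s) = List.replicate m true := by
  rw [List.eq_replicate_iff]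
  refine ⟨by simp, fun b hb => ?_⟩
  obtain ⟨i, hi, rfl⟩ := List.mem_map.1 hb
  exact letter_eq_true.2 (hs.isBoundary i (List.mem_range.1 hi))

theorem IsWheel.finiteMutationType_gr_two_four (hs : Δ.IsWheel s 2)
    (hT : ∀ t, ∃ i < 2, t = (s i).1) : (Δ.grQuiver 4).FiniteMutationType :=
  hs.finiteMutationType_of_complete (Δ.isLabelling_gr 4) hT (w := [true, true])
    (V := [(0, 1, 0, 3), (0, 2, 0, 2), (0, 3, 0, 1), (0, 1, 3, 0), (0, 2, 2, 0), (0, 3, 1, 0)])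
    hs.map_letter_isBoundary (by decide +kernel) (by decide +kernel)
    (B := Matrix.fourPunctured 0) (by decide +kernel) (Matrix.finiteMutationType_fourPunctured 0)

theorem IsWheel.finiteMutationType_gr_two_three (hs : Δ.IsWheel s 2)
    (hT : ∀ t, ∃ i < 2, t = (s i).1) : (Δ.grQuiver 3).FiniteMutationType :=
  hs.finiteMutationType_of_complete (Δ.isLabelling_gr 3) hT (w := [true, true])
    (V := [(0, 1, 0, 2), (0, 2, 0, 1), (0, 1, 2, 0), (0, 2, 1, 0)])
    hs.map_letter_isBoundary (by decide +kernel) (by decide +kernel)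
    (B := (Matrix.fourPunctured 0).submatrix ![0, 1, 2, 4] ![0, 1, 2, 4]) (by decide +kernel)
    ((Matrix.finiteMutationType_fourPunctured 0).submatrix (by decide))

theorem IsWheel.finiteMutationType_gr_three_three (hs : Δ.IsWheel s 3)
    (hT : ∀ t, ∃ i < 3, t = (s i).1) : (Δ.grQuiver 3).FiniteMutationType :=
  hs.finiteMutationType_of_complete (Δ.isLabelling_gr 3) hT (w := [true, true, true])
    (V := [(0, 1, 0, 2), (0, 2, 1, 0), (0, 2, 0, 1), (0, 1, 2, 0), (1, 1, 2, 0), (1, 2, 1, 0)])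
    hs.map_letter_isBoundary (by decide +kernel) (by decide +kernel)
    (B := Matrix.fourPunctured 2) (by decide +kernel) (Matrix.finiteMutationType_fourPunctured 2)

end Triangulation

/-! ### Counting in triangulations -/

namespace Triangulation

variable {T : Type*} {Δ : Triangulation T}

/-- The number of boundary intervals. -/
noncomputable def boundaryCard (Δ : Triangulation T) : ℕ := Set.ncard {s | Δ.IsBoundary s}

theorem mk_edge_eq_iff (Δ : Triangulation T) (s s' : T × Fin 3) :
    (Quot.mk _ s : Δ.Edge) = Quot.mk _ s' ↔ s' = s ∨ s' = Δ.glue s := by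
  constructor
  · intro h
    have hr : ∀ a b, Δ.glue a = b → (a = s ∨ a = Δ.glue s) = (b = s ∨ b = Δ.glue s) := by
      rintro a _ rfl
      refine propext ⟨?_, ?_⟩
      · rintro (rfl | rfl)
        · exact .inr rfl
        · exact .inl (Δ.glue_glue_apply s)
      · rintro (h | h)
        · exact .inr (by rw [← h, glue_glue_apply])
        · exact .inl (Δ.glue_glue.injective h)
    exact (congrArg (Quot.lift (fun a => a = s ∨ a = Δ.glue s) hr) h).mp (.inl rfl)
  · rintro (rfl | rfl)
    · rfl
    · exact Quot.sound rfl

theorem two_mul_card_edge [Fintype T] (Δ : Triangulation T) :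
    2 * Nat.card Δ.Edge = 3 * Fintype.card T + Δ.boundaryCard := by
  classical
  have : Finite Δ.Edge := Quot.finite _
  have := Fintype.ofFinite Δ.Edge
  have hfib : ∀ e : Δ.Edge, (Finset.univ.filter fun s => (Quot.mk _ s : Δ.Edge) = e).card +
      ((Finset.univ.filter fun s => Δ.IsBoundary s).filter
        fun s => (Quot.mk _ s : Δ.Edge) = e).card = 2 := by
    intro e
    obtain ⟨s, rfl⟩ := e.exists_rep
    have h1 : (Finset.univ.filter fun s' => (Quot.mk _ s' : Δ.Edge) = Quot.mk _ s) =
        {s, Δ.glue s} := by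
      ext s'
      simp only [Finset.mem_filter, Finset.mem_univ, true_and, Finset.mem_insert,
        Finset.mem_singleton]
      rw [eq_comm, mk_edge_eq_iff]
    have h2 : ((Finset.univ.filter fun s => Δ.IsBoundary s).filter
        fun s' => (Quot.mk _ s' : Δ.Edge) = Quot.mk _ s) =
        if Δ.IsBoundary s then {s} else ∅ := by
      ext s'
      simp only [Finset.mem_filter, Finset.mem_univ, true_and]
      rw [eq_comm (a := (Quot.mk _ s' : Δ.Edge)), mk_edge_eq_iff]
      split_ifs with hs
      · have hs' : Δ.glue s = s := hs
        rw [hs', or_self, Finset.mem_singleton]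
        exact ⟨fun h => h.2, fun h => ⟨h ▸ hs, h⟩⟩
      · simp only [Finset.notMem_empty, iff_false, not_and]
        rintro h (rfl | rfl)
        · exact hs h
        · exact not_isBoundary_glue hs h
    rw [h1, h2]
    by_cases hs : Δ.IsBoundary s
    · have hs' : Δ.glue s = s := hs
      simp [hs, hs']
    · rw [if_neg hs, Finset.card_pair (Ne.symm hs)]
      rfl
  have hsum := Finset.sum_congr (rfl : (Finset.univ : Finset Δ.Edge) = _) fun e _ => hfib e
  rw [Finset.sum_add_distrib, Finset.sum_const, Finset.card_univ, smul_eq_mul,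
    ← Finset.card_eq_sum_card_fiberwise (f := fun s => (Quot.mk _ s : Δ.Edge))
      (fun _ _ => Finset.mem_coe.2 (Finset.mem_univ _)),
    ← Finset.card_eq_sum_card_fiberwise (f := fun s => (Quot.mk _ s : Δ.Edge))
      (fun _ _ => Finset.mem_coe.2 (Finset.mem_univ _)), Finset.card_univ,
    Fintype.card_prod, Fintype.card_fin] at hsum
  have hb : Δ.boundaryCard = (Finset.univ.filter fun s => Δ.IsBoundary s).card := by
    rw [boundaryCard, ← Set.ncard_coe_finset]
    congr 1
    ext
    simp
  rw [Nat.card_eq_fintype_card, hb]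
  omega

theorem sum_boundaryLengths [Fintype T] (Δ : Triangulation T) :
    Δ.boundaryLengths.sum = Δ.boundaryCard := by
  classical
  rw [boundaryLengths]
  change ∑ c : Δ.Cycle, Δ.boundaryLength c = _
  have : ∀ c : Δ.Cycle, Δ.boundaryLength c = ((Finset.univ.filter fun s => Δ.IsBoundary s).filter
      fun s => (Quotient.mk _ s : Δ.Cycle) = c).card := by
    intro c
    rw [boundaryLength, Set.ncard_eq_toFinset_card']
    congr 1
    ext s
    simp
  rw [Finset.sum_congr rfl fun c _ => this c, ← Finset.card_eq_sum_card_fiberwise (by simp),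
    boundaryCard, Set.ncard_eq_toFinset_card']
  simp only [Set.toFinset_ofPred]

theorem sum_filter_pos (M : Multiset ℕ) : (M.filter (0 < ·)).sum = M.sum := by
  induction M using Multiset.induction with
  | empty => simp
  | cons a M ih =>
    rcases Nat.eq_zero_or_pos a with rfl | ha
    · simpa using ih
    · rw [Multiset.filter_cons_of_pos (p := (0 < ·)) _ ha, Multiset.sum_cons, Multiset.sum_cons, ih]

theorem Triangulates.boundaryCard [Fintype T] {S : MarkedSurface} (h : Δ.Triangulates S) :
    Δ.boundaryCard = S.boundary.sum := by
  rw [← h.boundary, sum_filter_pos, sum_boundaryLengths]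

/-- Walking around a puncture. -/
theorem Triangulates.exists_isWalk [Fintype T] {S : MarkedSurface} (h : Δ.Triangulates S)
    (hS : 1 ≤ S.punctures) : ∃ s, Δ.IsWalk s := by
  have h0 : 0 ∈ Δ.boundaryLengths := by
    rw [← Multiset.one_le_count_iff_mem, h.punctures]
    exact hS
  obtain ⟨c, -, hc⟩ := Multiset.mem_map.1 h0
  obtain ⟨s, rfl⟩ := c.exists_rep
  rw [boundaryLength, Set.ncard_eq_zero] at hc
  have hcyc : ∀ s', Δ.turn.SameCycle s' s → ¬ Δ.IsBoundary s' := fun s' hs' hb => by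
    have : s' ∈ (∅ : Set (T × Fin 3)) := by
      rw [← hc]
      exact ⟨hb, Quotient.sound hs'⟩
    exact this
  have hpow : ∀ n : ℤ, ¬ Δ.IsBoundary ((Δ.turn ^ n) s) := fun n =>
    hcyc _ (Equiv.Perm.SameCycle.symm ⟨n, rfl⟩)
  refine ⟨fun i => (Δ.turn ^ i) s, fun i => by rw [pow_succ']; rfl, fun i => hpow i, fun i => ?_⟩
  have h1 : (Δ.turn ^ i) s = Δ.turn ((Δ.turn ^ ((i : ℤ) - 1)) s) := by
    rw [← Equiv.Perm.mul_apply, ← zpow_one_add, add_sub_cancel, zpow_natCast]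
  have h2 := not_isBoundary_glue (hpow ((i : ℤ) - 1))
  rw [h1, turn_apply, add_assoc]
  change ¬ Δ.IsBoundary (_, _ + 0)
  rwa [add_zero]

namespace IsWheel

variable {s : ℕ → T × Fin 3} {m : ℕ}

theorem period (hs : Δ.IsWheel s m) (i : ℕ) : s (m + i) = s i := by
  induction i with
  | zero => exact hs.closes
  | succ i ih => rw [← add_assoc, hs.succ, ih, hs.succ]

theorem exists_lt (hs : Δ.IsWheel s m) (i : ℕ) : ∃ j < m, s i = s j := by
  have hm := hs.two_le
  induction i using Nat.strong_induction_on with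
  | _ i ih =>
    rcases lt_or_ge i m with h | h
    · exact ⟨i, h, rfl⟩
    · obtain ⟨n, rfl⟩ := Nat.exists_eq_add_of_le h
      obtain ⟨j, hj, he⟩ := ih n (by omega)
      exact ⟨j, hj, by rw [hs.period, he]⟩

theorem isBoundary' (hs : Δ.IsWheel s m) (i : ℕ) : Δ.IsBoundary ((s i).1, (s i).2 + 1) := by
  obtain ⟨j, hj, he⟩ := hs.exists_lt i
  rw [he]
  exact hs.isBoundary j hj

theorem glue_right (hs : Δ.IsWheel s m) (i : ℕ) :
    Δ.glue ((s (i + 1)).1, (s (i + 1)).2 + 2) = s i := by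
  rw [← hs.glue_eq, glue_glue_apply]

theorem exists_pred (hs : Δ.IsWheel s m) (i : ℕ) : ∃ j, s i = s (j + 1) := by
  have hm := hs.two_le
  exact ⟨m + i - 1, by rw [Nat.sub_add_cancel (by omega), hs.period]⟩

theorem exists_triangle [Fintype T] (hs : Δ.IsWheel s m) {S : MarkedSurface}
    (h : Δ.Triangulates S) (t : T) : ∃ i < m, t = (s i).1 := by
  suffices ∃ i, t = (s i).1 by
    obtain ⟨i, rfl⟩ := this
    obtain ⟨j, hj, he⟩ := hs.exists_lt i
    exact ⟨j, hj, by rw [he]⟩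
  induction h.connected (s 0).1 t with
  | refl => exact ⟨0, rfl⟩
  | tail _ hab ih =>
    obtain ⟨i, rfl⟩ := ih
    obtain ⟨a, b, hg⟩ := hab
    obtain ⟨a, rfl⟩ : ∃ c, a = (s i).2 + c := ⟨a - (s i).2, by rw [add_sub_cancel]⟩
    have ha : a = 0 ∨ a = 1 ∨ a = 2 := by clear hg; revert a; decide
    rcases ha with rfl | rfl | rfl
    · rw [add_zero, Prod.mk.eta, hs.glue_eq] at hg
      exact ⟨i + 1, (congrArg Prod.fst hg).symm⟩
    · rw [hs.isBoundary' i] at hg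
      exact ⟨i, (congrArg Prod.fst hg).symm⟩
    · obtain ⟨j, hj⟩ := hs.exists_pred i
      rw [hj, hs.glue_right] at hg
      exact ⟨j, (congrArg Prod.fst hg).symm⟩

theorem isBoundary_iff (hs : Δ.IsWheel s m) (i : ℕ) (j : Fin 3) :
    Δ.IsBoundary ((s i).1, (s i).2 + j) ↔ j = 1 := by
  have hj : j = 0 ∨ j = 1 ∨ j = 2 := by revert j; decide
  rcases hj with rfl | rfl | rfl
  · simpa using hs.left i
  · simpa using hs.isBoundary' i
  · simpa using hs.right i

variable [Fintype T] {S : MarkedSurface}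

theorem bijective (hs : Δ.IsWheel s m) (h : Δ.Triangulates S) :
    (fun i : Fin m => (s i).1).Bijective :=
  ⟨fun i j hij => Fin.ext (hs.inj i i.2 j j.2 hij), fun t => by
    obtain ⟨i, hi, rfl⟩ := hs.exists_triangle h t
    exact ⟨⟨i, hi⟩, rfl⟩⟩

theorem card_eq (hs : Δ.IsWheel s m) (h : Δ.Triangulates S) : Fintype.card T = m := by
  rw [← Fintype.card_of_bijective (hs.bijective h), Fintype.card_fin]

theorem exists_side (hs : Δ.IsWheel s m) (h : Δ.Triangulates S) (u : T × Fin 3) :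
    ∃ i < m, ∃ j, u = ((s i).1, (s i).2 + j) := by
  obtain ⟨i, hi, hu⟩ := hs.exists_triangle h u.1
  exact ⟨i, hi, u.2 - (s i).2, Prod.ext hu (by rw [add_sub_cancel])⟩

theorem boundaryCard_eq (hs : Δ.IsWheel s m) (h : Δ.Triangulates S) : Δ.boundaryCard = m := by
  have hset : {u | Δ.IsBoundary u} =
      Set.range fun i : Fin m => ((s i).1, (s i).2 + 1) := by
    ext u
    obtain ⟨i, hi, j, rfl⟩ := hs.exists_side h u
    rw [Set.mem_ofPred_eq, hs.isBoundary_iff, Set.mem_range]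
    constructor
    · rintro rfl
      exact ⟨⟨i, hi⟩, rfl⟩
    · rintro ⟨i', hi'⟩
      have := hs.inj i' i'.2 i hi (Prod.mk.inj hi').1
      rw [this] at hi'
      exact (add_left_cancel (congrArg Prod.snd hi')).symm
  rw [boundaryCard, hset, ← Set.image_univ, Set.ncard_image_of_injective, Set.ncard_univ,
    Nat.card_eq_fintype_card, Fintype.card_fin]
  exact fun i j hij => (hs.bijective h).1 (Prod.mk.inj hij).1

theorem boundaryLengths_eq (hs : Δ.IsWheel s m) (h : Δ.Triangulates S) :
    Δ.boundaryLengths = {0, m} := by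
  classical
  have hm := hs.two_le
  set c₀ : Δ.Cycle := Quotient.mk _ (s 0) with hc₀
  set c₁ : Δ.Cycle := Quotient.mk _ ((s 0).1, (s 0).2 + 1) with hc₁
  have hturn : ∀ u, (Quotient.mk _ (Δ.turn u) : Δ.Cycle) = Quotient.mk _ u := fun u =>
    Quotient.sound (Equiv.Perm.SameCycle.symm ⟨1, rfl⟩)
  have h0 : ∀ i, (Quotient.mk _ (s i) : Δ.Cycle) = c₀ := by
    intro i
    induction i with
    | zero => rfl
    | succ i ih => rw [hs.succ, hturn, ih]
  have h2 : ∀ i, Δ.turn ((s i).1, (s i).2 + 1) = ((s i).1, (s i).2 + 2) := by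
    intro i
    rw [turn_apply, hs.isBoundary' i, add_assoc]
    rfl
  have h3 : ∀ i, Δ.turn ((s (i + 1)).1, (s (i + 1)).2 + 2) = ((s i).1, (s i).2 + 1) := by
    intro i
    rw [turn_apply, hs.glue_right]
  have h1 : ∀ i, (Quotient.mk _ ((s i).1, (s i).2 + 1) : Δ.Cycle) = c₁ := by
    intro i
    induction i with
    | zero => rfl
    | succ i ih => rw [← hturn, h2, ← hturn, h3, ih]
  have hall : ∀ c : Δ.Cycle, c = c₀ ∨ c = c₁ := by
    intro c
    obtain ⟨u, rfl⟩ := c.exists_rep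
    obtain ⟨i, hi, j, rfl⟩ := hs.exists_side h u
    have hj : j = 0 ∨ j = 1 ∨ j = 2 := by revert j; decide
    rcases hj with rfl | rfl | rfl
    · left
      rw [add_zero]
      exact h0 i
    · exact .inr (h1 i)
    · right
      rw [← h2, hturn]
      exact h1 i
  have hlen0 : Δ.boundaryLength c₀ = 0 := by
    rw [boundaryLength, Set.ncard_eq_zero, Set.eq_empty_iff_forall_notMem]
    rintro u ⟨hu, huc⟩
    obtain ⟨n, hn⟩ := (Quotient.exact huc.symm : Δ.turn.SameCycle (s 0) u).exists_nat_pow_eq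
    rw [← hs.eq_pow] at hn
    exact hs.left n (hn ▸ hu)
  have hne : c₀ ≠ c₁ := by
    intro heq
    rw [boundaryLength, Set.ncard_eq_zero, Set.eq_empty_iff_forall_notMem] at hlen0
    exact hlen0 _ ⟨hs.isBoundary' 0, heq.symm⟩
  have huniv : (Finset.univ : Finset Δ.Cycle) = {c₀, c₁} := by
    ext c
    simpa using hall c
  have hval : Δ.boundaryLengths = {Δ.boundaryLength c₀, Δ.boundaryLength c₁} := by
    rw [boundaryLengths]
    have : (Finset.univ : Finset Δ.Cycle).val = {c₀, c₁} := by
      rw [huniv, Finset.insert_val_of_notMem (by simpa using hne)]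
      rfl
    simp only [← Multiset.map_singleton, ← Multiset.map_cons, Multiset.insert_eq_cons] at this ⊢
    convert congrArg (Multiset.map Δ.boundaryLength) this using 3
  have hsum := sum_boundaryLengths Δ
  rw [hs.boundaryCard_eq h, hval, hlen0] at hsum
  rw [hval, hlen0]
  simp only [Multiset.insert_eq_cons, Multiset.sum_cons, Multiset.sum_singleton, zero_add] at hsum
  rw [hsum]

/-- The triangles of a wheel form a once-punctured polygon. -/
theorem eq_polygon (hs : Δ.IsWheel s m) (h : Δ.Triangulates S) [NeZero m] :
    S = MarkedSurface.polygon m 1 := by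
  have hm : 0 < m := Nat.pos_of_ne_zero (NeZero.ne m)
  have hp := h.punctures
  have hb := h.boundary
  have hg := h.genus
  rw [hs.boundaryLengths_eq h] at hp hb
  have hb' : S.boundary = {m} := by
    rw [← hb]
    simp [Multiset.filter_singleton, hm]
  have hp' : S.punctures = 1 := by
    rw [← hp]
    simp [hm.ne]
  have he := two_mul_card_edge Δ
  rw [hs.card_eq h, hs.boundaryCard_eq h] at he
  rw [hb', hp', hs.card_eq h] at hg
  simp only [Multiset.sum_singleton, Multiset.card_singleton] at hg
  push_cast at hg
  apply MarkedSurface.ext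
  · change S.genus = 0
    omega
  · exact hp'
  · exact hb'

end IsWheel

/-- The triangulations of a once-punctured polygon in which each triangle has at most one side on
the boundary are wheels. -/
theorem Taut.exists_isWheel [Fintype T] {n : ℕ} [NeZero n] (hΔ : Δ.Taut)
    (h : Δ.Triangulates (MarkedSurface.polygon n 1)) : ∃ s, Δ.IsWheel s n := by
  obtain ⟨s, hs⟩ := h.exists_isWalk le_rfl
  have hcard : Fintype.card T = n ∧ Δ.boundaryCard = n := by
    have hb := h.boundaryCard
    have he := two_mul_card_edge Δ
    have hg := h.genus
    simp only [MarkedSurface.polygon, Multiset.sum_singleton, Multiset.card_singleton] at hg hb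
    push_cast at hg
    omega
  have hinj : Function.Injective fun u : {u | Δ.IsBoundary u} => u.1.1 := by
    rintro ⟨⟨t, i⟩, hi⟩ ⟨⟨t', j⟩, hj⟩ rfl
    exact Subtype.ext (Prod.ext rfl (hΔ.2 t i j hi hj))
  have hsurj := ((Nat.bijective_iff_injective_and_card _).2 ⟨hinj, by
    rw [Nat.card_coe_set_eq, Nat.card_eq_fintype_card, hcard.1]
    exact hcard.2⟩).2
  have hside : ∀ i, Δ.IsBoundary ((s i).1, (s i).2 + 1) := by
    intro i
    obtain ⟨⟨⟨t, j⟩, hj⟩, rfl⟩ : ∃ u : {u | Δ.IsBoundary u}, u.1.1 = (s i).1 := hsurj _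
    obtain ⟨a, rfl⟩ : ∃ a, j = (s i).2 + a := ⟨j - (s i).2, by rw [add_sub_cancel]⟩
    have ha : a = 0 ∨ a = 1 ∨ a = 2 := by clear hj; revert a; decide
    rcases ha with rfl | rfl | rfl
    · exact absurd hj (by rw [add_zero]; exact hs.left i)
    · exact hj
    · exact absurd hj (hs.right i)
  rcases hs.distinct_or hΔ.1 (n + 1) with hd | ⟨m, h2, -, hinj', hc | ⟨i, hi, hc⟩⟩
  · have := Fintype.card_le_of_injective (fun i : Fin (n + 1) => (s i).1)
      fun i j hij => Fin.ext (hd i i.2 j j.2 hij)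
    rw [Fintype.card_fin, hcard.1] at this
    omega
  · have hw : Δ.IsWheel s m := ⟨hs, h2, hinj', hc, fun i _ => hside i⟩
    have := hw.card_eq h
    rw [hcard.1] at this
    subst this
    exact ⟨s, hw⟩
  · exact absurd (hside i) (hs.twist_side hi hc)

/-- A regular triangulation of the once-punctured digon is taut. -/
theorem Regular.taut_of_digon [Fintype T] (hΔ : Δ.Regular)
    (h : Δ.Triangulates (MarkedSurface.polygon 2 1)) : Δ.Taut := by
  refine ⟨hΔ, fun t i j hi hj => ?_⟩
  obtain ⟨s, hs⟩ := h.exists_isWalk le_rfl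
  have hcard : Fintype.card T = 2 := by
    have hb := h.boundaryCard
    have he := two_mul_card_edge Δ
    have hg := h.genus
    simp only [MarkedSurface.polygon, Multiset.sum_singleton, Multiset.card_singleton] at hg hb
    push_cast at hg
    omega
  have hinj : Function.Injective fun i : Fin 2 => (s i).1 := by
    have h01 : (s 1).1 ≠ (s 0).1 := hs.fst_ne hΔ 0
    intro i j hij
    fin_cases i <;> fin_cases j
    · rfl
    · exact absurd hij.symm h01
    · exact absurd hij h01
    · rfl
  obtain ⟨n, rfl⟩ := ((Fintype.bijective_iff_injective_and_card _).2
    ⟨hinj, by rw [hcard, Fintype.card_fin]⟩).2 t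
  have key : ∀ j, Δ.IsBoundary ((s n).1, j) → j = (s n).2 + 1 := by
    intro j hj
    obtain ⟨a, rfl⟩ : ∃ a, j = (s n).2 + a := ⟨j - (s n).2, by rw [add_sub_cancel]⟩
    have ha : a = 0 ∨ a = 1 ∨ a = 2 := by clear hj; revert a; decide
    rcases ha with rfl | rfl | rfl
    · exact absurd hj (by rw [add_zero]; exact hs.left n)
    · rfl
    · exact absurd hj (hs.right n)
  rw [key i hi, key j hj]

end Triangulation

/-- Classification of the cluster algebras `A(SL_k, S)` and `A'(SL_k, S)` of finite mutation type,
for marked surfaces `S` with at least one puncture. -/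
theorem proposition9p1 (k : ℕ) (hk : 3 ≤ k) (S : MarkedSurface) (hS : 1 ≤ S.punctures)
    {T : Type*} [Fintype T] (Δ : Triangulation T) (hΔ : Δ.Triangulates S) :
    (Δ.Regular →
      ((Δ.fgQuiver k).FiniteMutationType ↔ S = MarkedSurface.polygon 2 1 ∧ k = 3)) ∧
    (Δ.Taut →
      ((Δ.grQuiver k).FiniteMutationType ↔
        (S = MarkedSurface.polygon 2 1 ∧ (k = 3 ∨ k = 4)) ∨
        (S = MarkedSurface.polygon 3 1 ∧ k = 3))) := by
  obtain ⟨s, hs⟩ := hΔ.exists_isWalk hS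
  refine ⟨fun hreg => ⟨fun hfin => ?_, ?_⟩, fun htaut => ⟨fun hfin => ?_, ?_⟩⟩
  · obtain ⟨s', m, hw, ⟨rfl, rfl⟩ | ⟨⟨_, h⟩, -⟩⟩ :=
      hs.exists_isWheel (Δ.isLabelling_fg k) hreg (fun _ _ _ h => h.elim) hk hfin
    · exact ⟨hw.eq_polygon hΔ, rfl⟩
    · exact h.elim
  · rintro ⟨rfl, rfl⟩
    obtain ⟨s', hw⟩ := (hreg.taut_of_digon hΔ).exists_isWheel hΔ
    exact hw.finiteMutationType_fg (hw.exists_triangle hΔ)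
  · obtain ⟨s', m, hw, ⟨rfl, rfl⟩ | ⟨-, ⟨rfl, rfl⟩ | ⟨rfl, rfl⟩⟩⟩ :=
      hs.exists_isWheel (Δ.isLabelling_gr k) htaut.1 htaut.2 hk hfin
    · exact .inl ⟨hw.eq_polygon hΔ, .inl rfl⟩
    · exact .inl ⟨hw.eq_polygon hΔ, .inr rfl⟩
    · exact .inr ⟨hw.eq_polygon hΔ, rfl⟩
  · rintro (⟨rfl, rfl | rfl⟩ | ⟨rfl, rfl⟩) <;> obtain ⟨s', hw⟩ := htaut.exists_isWheel hΔ
    · exact hw.finiteMutationType_gr_two_three (hw.exists_triangle hΔ)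
    · exact hw.finiteMutationType_gr_two_four (hw.exists_triangle hΔ)
    · exact hw.finiteMutationType_gr_three_three (hw.exists_triangle hΔ)
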